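/- Let $H(\mathbb C)$ be the algebra of entire functions with the compact-open topology, and let $D$ denote complex differentiation on it. For an entire function $f$ put $M_f(r)=\sup_{|z|\le r}|f(z)|$. The order of $f$ is $\rho_f=\limsup_{r\to\infty}\frac{\log\log M_f(r)}{\log r}$ (and $\rho_f=0$ if $f$ is constant), and if $\rho_f<\infty$ the type of $f$ is $\limsup_{r\to\infty}r^{-\rho_f}\log M_f(r)$; $f$ is of growth $(\rho,\tau)$ if its order is less than $\rho$, or its order equals $\rho$ and its type is at most $\tau$. Let $a\in\mathbb C$ and let $\varphi$ be a non-constant entire function of growth $(\tfrac12,0)$ with $|\varphi(0)|=1$ and $$\operatorname{Im}\bigl(a\,\varphi(0)\,\overline{\varphi'(0)}\bigr)\ne 0.$$ Put $\Phi(z)=e^{az}\varphi(z)=\sum_{n\ge 0}a_nz^n$. Then the series $\Phi(D)f=\sum_{n\ge0}a_nD^nf$ converges unconditionally in $H(\mathbb C)$ for every $f\in H(\mathbb C)$ and defines a continuous linear operator $\Phi(D)$ on $H(\mathbb C)$, and $\Phi(D)$ supports a hypercyclic algebra: there is a non-zero subalgebra $A$ of $H(\mathbb C)$ (not required to contain the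 constants) such that for every $f\in A\setminus\{0\}$ the orbit $\{\Phi(D)^nf:n\ge0\}$ is dense in $H(\mathbb C)$. -/

import Mathlib

/-- The algebra `H(ℂ)` of entire functions, as a subalgebra of `C(ℂ, ℂ)`; the topology it
inherits is the compact-open topology (locally uniform convergence). -/
def EntireFunctions : Subalgebra ℂ C(ℂ, ℂ) where
  carrier := {f | Differentiable ℂ f}
  mul_mem' := fun {f g} (hf : Differentiable ℂ f) (hg : Differentiable ℂ g) => hf.mul hg
  add_mem' := fun {f g} (hf : Differentiable ℂ f) (hg : Differentiable ℂ g) => hf.add hg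
  algebraMap_mem' := fun c => differentiable_const c

theorem differentiable_deriv_entire (f : EntireFunctions) :
    Differentiable ℂ (deriv (f : C(ℂ, ℂ))) := by
  have hf : Differentiable ℂ (f : C(ℂ, ℂ)) := f.2
  exact differentiableOn_univ.mp (hf.differentiableOn.deriv isOpen_univ)

/-- The operator `D` of complex differentiation on `H(ℂ)`. -/
noncomputable def entireD : EntireFunctions →ₗ[ℂ] EntireFunctions where
  toFun f := ⟨⟨deriv (f : C(ℂ, ℂ)), (differentiable_deriv_entire f).continuous⟩,
    differentiable_deriv_entire f⟩
  map_add' f g := by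
    have hf : Differentiable ℂ (f : C(ℂ, ℂ)) := f.2
    have hg : Differentiable ℂ (g : C(ℂ, ℂ)) := g.2
    ext z
    exact deriv_add (hf z) (hg z)
  map_smul' c f := by
    have hf : Differentiable ℂ (f : C(ℂ, ℂ)) := f.2
    ext z
    exact deriv_const_smul c (hf z)

/-- The `n`-th term `aₙ Dⁿ f` of the series defining `Φ(D) f`, where `aₙ = Φ⁽ⁿ⁾(0) / n!` is the
`n`-th Taylor coefficient of `Φ` at the origin. -/
noncomputable def convolutionTerm (Φ : ℂ → ℂ) (f : EntireFunctions) (n : ℕ) : EntireFunctions :=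
  (iteratedDeriv n Φ 0 / (n.factorial : ℂ)) • (entireD ^ n) f

/-- The map `Φ(D) : f ↦ ∑ₙ aₙ Dⁿ f`, the series being summed in `H(ℂ)`.
(It is meaningful when all these series converge, as for `Φ` of exponential type.) -/
noncomputable def convolutionOperator (Φ : ℂ → ℂ) (f : EntireFunctions) : EntireFunctions :=
  ∑' n, convolutionTerm Φ f n

/-- The maximum modulus `M(r) = sup_{|z| ≤ r} |f(z)|`. -/
noncomputable def maxModulus (f : ℂ → ℂ) (r : ℝ) : ℝ :=
  sSup ((fun z => ‖f z‖) '' Metric.closedBall 0 r)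

open Classical in
/-- The order of an entire function: `0` for a constant, and
`limsup_{r → ∞} log log M(r) / log r` otherwise. -/
noncomputable def growthOrder (f : ℂ → ℂ) : EReal :=
  if ∃ c, ∀ z, f z = c then 0
  else Filter.limsup
    (fun r : ℝ => ((Real.log (Real.log (maxModulus f r)) / Real.log r : ℝ) : EReal)) Filter.atTop

/-- The type `limsup_{r → ∞} r^{-ρ} log M(r)` of an entire function of finite order `ρ`. -/
noncomputable def growthType (f : ℂ → ℂ) : EReal :=
  Filter.limsup
    (fun r : ℝ => ((r ^ (-(growthOrder f).toReal) * Real.log (maxModulus f r) : ℝ) : EReal))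
    Filter.atTop

/-- `f` is of growth `(ρ, τ)`: its order is less than `ρ`, or equal to `ρ` with type at most `τ`. -/
def IsOfGrowth (f : ℂ → ℂ) (ρ τ : ℝ) : Prop :=
  growthOrder f < (ρ : EReal) ∨ (growthOrder f = (ρ : EReal) ∧ growthType f ≤ (τ : EReal))

/-- `x` is a hypercyclic vector for `T`: its orbit `{Tⁿ x : n ≥ 0}` is dense. -/
def IsHypercyclicVector {X : Type*} [TopologicalSpace X] (T : X → X) (x : X) : Prop :=
  Dense (Set.range fun n : ℕ => T^[n] x)

/-- `T` supports a hypercyclic algebra: there is a non-zero subalgebra (not required to contain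
the unit) all of whose non-zero elements are hypercyclic vectors for `T`. -/
def SupportsHypercyclicAlgebra {X : Type*} [TopologicalSpace X] [CommRing X] [Algebra ℂ X]
    (T : X → X) : Prop :=
  ∃ A : NonUnitalSubalgebra ℂ X, A ≠ ⊥ ∧ ∀ x ∈ A, x ≠ 0 → IsHypercyclicVector T x

/-! The exponentials $e_\mu(z)=e^{\mu z}$ satisfy $e_\mu e_\nu=e_{\mu+\nu}$ and
$\Phi(D)e_\mu=\Phi(\mu)e_\mu$, so powers of a combination of exponentials, and their images under
$\Phi(D)^n$, can be computed exactly. By Baire it suffices, for each $m$, to perturb a given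
function to some $f$ for which $\Phi(D)^n(f^m)$ is near a given target while $\Phi(D)^n(f^j)$ is
small for $1\le j<m$ (`PowerTransitive`). A generic $f$ has this property for all $m$, and the
polynomials in $f$ without constant term form the algebra.

To perturb, approximate the given function by exponentials with frequencies $\gamma$ near $0$ and
the target by $\sum\beta_\lambda e_\lambda$ with $|\Phi(\lambda)|>1$. Then add $\sum c_\lambda
q_\lambda^n e_{\lambda/m}$, where $c_\lambda^m=\beta_\lambda$ and $q_\lambda^m\Phi(\lambda)=1$. The
pure $m$-th powers of the added terms reproduce the target. Every other product must be contracted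
(`exists_pow_mem_of_eigenvectors`).

The contraction is geometric. The condition on the imaginary part gives a direction $w$ with $aw$
imaginary, so that $|\Phi|=|\varphi|$ on the ray, and along which $|\varphi|$ first drops below $1$.
Growth $(1/2,0)$ forbids boundedness on a ray (Phragmén–Lindelöf,
`exists_eq_const_of_bounded_on_ray`), so $|\varphi|$ returns to $1$ at a first point $t_0w$. With
$\gamma$ on the ray near $0$ and $\lambda$ near $t_0w$, mixed sums of frequencies stay near the part
of the ray where $|\Phi|<1$. Products of $m$ terms $e_{\lambda_i/m}$ with different $\lambda_i$ are
handled by Jensen's inequality, the $\lambda$ lying on a segment where $\log|\Phi|$ is strictly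
convex (`powerTransitive_of_ray`). -/

open Filter Topology Polynomial Uniformity

/-! ### Baire category: from transitivity to a hypercyclic algebra. -/

/-- The Birkhoff-type transitivity property that produces, through the Baire category theorem,
a singly generated hypercyclic algebra. -/
def PowerTransitive {X : Type*} [TopologicalSpace X] [CommRing X] (T : X → X) : Prop :=
  ∀ m : ℕ, 1 ≤ m → ∀ U V W : Set X, IsOpen U → U.Nonempty → IsOpen V → V.Nonempty →
    IsOpen W → (0 : X) ∈ W →
    ∃ f ∈ U, ∃ n : ℕ, T^[n] (f ^ m) ∈ V ∧ ∀ j, 1 ≤ j → j < m → T^[n] (f ^ j) ∈ W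

/-- Restricting $V$ and $W$ to a countable basis leaves countably many conditions on $f$. Each is
open, since only finitely many powers occur, and dense by transitivity, so Baire gives a common
solution. -/
theorem PowerTransitive.exists_generator {X : Type*} [TopologicalSpace X] [CommRing X]
    [ContinuousMul X] [BaireSpace X] [SecondCountableTopology X] [Nonempty X] {T : X → X}
    (hT : Continuous T) (h : PowerTransitive T) :
    ∃ f : X, ∀ m : ℕ, 1 ≤ m → ∀ V W : Set X, IsOpen V → V.Nonempty → IsOpen W → (0 : X) ∈ W →
      ∃ n : ℕ, T^[n] (f ^ m) ∈ V ∧ ∀ j, 1 ≤ j → j < m → T^[n] (f ^ j) ∈ W := by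
  classical
  let B := TopologicalSpace.countableBasis X
  let G : {m : ℕ // 1 ≤ m} × B × {W : B // (0 : X) ∈ W.1} → Set X := fun i =>
    {f | ∃ n : ℕ, T^[n] (f ^ i.1.1) ∈ i.2.1.1 ∧
      ∀ j ∈ Finset.Ico 1 i.1.1, T^[n] (f ^ j) ∈ i.2.2.1.1}
  have hB := TopologicalSpace.isBasis_countableBasis X
  have : Countable B := (TopologicalSpace.countable_countableBasis X).to_subtype
  have hc : ∀ n j : ℕ, Continuous fun f : X => T^[n] (f ^ j) := fun n j =>
    (hT.iterate n).comp (continuous_pow j)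
  have hopen : ∀ i, IsOpen (G i) := by
    rintro ⟨m, V, W⟩
    have : G ⟨m, V, W⟩ = ⋃ n : ℕ, ((fun f : X => T^[n] (f ^ m.1)) ⁻¹' V.1 ∩
        ⋂ j ∈ Finset.Ico 1 m.1, (fun f : X => T^[n] (f ^ j)) ⁻¹' W.1.1) := by
      ext f
      simp [G]
    rw [this]
    refine isOpen_iUnion fun n => ((hB.isOpen V.2).preimage (hc _ _)).inter ?_
    exact isOpen_biInter_finset fun j _ => (hB.isOpen W.1.2).preimage (hc _ _)
  have hdense : ∀ i, Dense (G i) := by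
    rintro ⟨m, V, W⟩
    refine dense_iff_inter_open.2 fun U hU hUne => ?_
    obtain ⟨f, hf, n, h1, h2⟩ := h m.1 m.2 U V.1 W.1.1 hU hUne (hB.isOpen V.2)
      (TopologicalSpace.nonempty_of_mem_countableBasis V.2) (hB.isOpen W.1.2) W.2
    refine ⟨f, hf, n, h1, fun j hj => ?_⟩
    rw [Finset.mem_Ico] at hj
    exact h2 j hj.1 hj.2
  obtain ⟨f, hf⟩ := (dense_iInter_of_isOpen hopen hdense).nonempty
  refine ⟨f, fun m hm V W hV hVne hW hW0 => ?_⟩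
  obtain ⟨v, hv⟩ := hVne
  obtain ⟨V', hV', -, hVV⟩ := hB.exists_subset_of_mem_open hv hV
  obtain ⟨W', hW', hW0', hWW⟩ := hB.exists_subset_of_mem_open hW0 hW
  obtain ⟨n, h1, h2⟩ := Set.mem_iInter.1 hf ⟨⟨m, hm⟩, ⟨V', hV'⟩, ⟨⟨W', hW'⟩, hW0'⟩⟩
  exact ⟨n, hVV h1, fun j hj hj' => hWW (h2 j (Finset.mem_Ico.2 ⟨hj, hj'⟩))⟩

/-- Along suitable $n$ only the leading term of $p(f)$ survives: the lower powers of $f$ are sent to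
$0$ and there is no constant term. Hence every nonzero such $p$ gives a hypercyclic vector. -/
theorem PowerTransitive.supportsHypercyclicAlgebra {X : Type*} [TopologicalSpace X] [CommRing X]
    [Algebra ℂ X] [IsTopologicalRing X] [ContinuousSMul ℂ X] [BaireSpace X]
    [SecondCountableTopology X] [T1Space X] [Nontrivial X] {T : X →L[ℂ] X}
    (h : PowerTransitive T) : SupportsHypercyclicAlgebra T := by
  obtain ⟨f, hf⟩ := h.exists_generator T.continuous
  have key : ∀ p : ℂ[X], p.coeff 0 = 0 → p ≠ 0 → IsHypercyclicVector T (aeval f p) := by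
    intro p hp0 hp
    have hm : 1 ≤ p.natDegree := by
      by_contra hlt
      have h0 : p.natDegree = 0 := by omega
      apply hp
      rw [eq_C_of_natDegree_eq_zero h0, hp0, C_0]
    have hlc : p.leadingCoeff ≠ 0 := leadingCoeff_ne_zero.2 hp
    set m := p.natDegree with hmdef
    refine dense_iff_inter_open.2 fun U hU ⟨u, hu⟩ => ?_
    -- The target for $f^m$ is rescaled so that the leading coefficient turns it into $u$.
    set v : X := p.leadingCoeff⁻¹ • u with hv
    obtain ⟨Vs, hVs⟩ := (𝓝 v).exists_antitone_basis
    obtain ⟨Ws, hWs⟩ := (𝓝 (0 : X)).exists_antitone_basis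
    have hex : ∀ k : ℕ, ∃ n : ℕ, T^[n] (f ^ m) ∈ interior (Vs k) ∧
        ∀ j, 1 ≤ j → j < m → T^[n] (f ^ j) ∈ interior (Ws k) := fun k =>
      hf m hm _ _ isOpen_interior ⟨v, mem_interior_iff_mem_nhds.2 (hVs.mem k)⟩ isOpen_interior
        (mem_interior_iff_mem_nhds.2 (hWs.mem k))
    choose n hn1 hn2 using hex
    have ht1 : Tendsto (fun k => T^[n k] (f ^ m)) atTop (𝓝 v) :=
      hVs.tendsto fun k => interior_subset (hn1 k)
    have ht2 : ∀ j, 1 ≤ j → j < m → Tendsto (fun k => T^[n k] (f ^ j)) atTop (𝓝 0) :=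
      fun j hj hj' => hWs.tendsto fun k => interior_subset (hn2 k j hj hj')
    have hsum : ∀ k, T^[n k] (aeval f p) =
        ∑ j ∈ Finset.range m, p.coeff j • T^[n k] (f ^ j) +
          p.leadingCoeff • T^[n k] (f ^ m) := by
      intro k
      rw [aeval_eq_sum_range, ← hmdef, Finset.sum_range_succ, ← FunLike.coe_pow_eq_iterate]
      simp only [map_add, map_sum, map_smul]
      rfl
    have ht : Tendsto (fun k => T^[n k] (aeval f p)) atTop (𝓝 u) := by
      simp only [hsum]
      have e : u = ∑ j ∈ Finset.range m, (0 : X) + p.leadingCoeff • v := by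
        simp [hv, smul_smul, mul_inv_cancel₀ hlc]
      rw [e]
      refine (tendsto_finsetSum _ fun j hj => ?_).add (ht1.const_smul _)
      rcases Nat.eq_zero_or_pos j with rfl | hj0
      · simp [hp0]
      · simpa using (ht2 j hj0 (Finset.mem_range.1 hj)).const_smul (p.coeff j)
    obtain ⟨k, hk⟩ := (ht.eventually (hU.mem_nhds hu)).exists
    exact ⟨_, hk, n k, rfl⟩
  refine ⟨{ carrier := {x | ∃ p : ℂ[X], p.coeff 0 = 0 ∧ aeval f p = x}
            add_mem' := ?_, zero_mem' := ⟨0, by simp⟩, mul_mem' := ?_, smul_mem' := ?_ }, ?_, ?_⟩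
  · rintro _ _ ⟨p, hp, rfl⟩ ⟨q, hq, rfl⟩
    exact ⟨p + q, by simp [hp, hq], by simp⟩
  · rintro _ _ ⟨p, hp, rfl⟩ ⟨q, hq, rfl⟩
    exact ⟨p * q, by simp [mul_coeff_zero, hp], by simp⟩
  · rintro c _ ⟨p, hp, rfl⟩
    exact ⟨c • p, by simp [hp], by simp⟩
  -- If the algebra were zero then $f=0$, whose orbit $\{0\}$ is not dense.
  · intro hbot
    have hfmem : f ∈ (⊥ : NonUnitalSubalgebra ℂ X) := by
      rw [← hbot]
      exact ⟨Polynomial.X, by simp, by simp⟩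
    have hf0 : f = 0 := (NonUnitalAlgebra.mem_bot).1 hfmem
    have hd := key Polynomial.X (by simp) X_ne_zero
    have hsub : Set.range (fun n : ℕ => T^[n] (aeval f (Polynomial.X : ℂ[X]))) ⊆ {0} := by
      rintro _ ⟨n, rfl⟩
      simp [hf0]
    have := (Dense.mono hsub hd).closure_eq
    rw [closure_singleton] at this
    obtain ⟨x, hx⟩ := exists_ne (0 : X)
    exact hx (by simpa using this.ge (Set.mem_univ x))
  · rintro _ ⟨p, hp, rfl⟩ hx
    exact key p hp (by rintro rfl; simp at hx)

/-! ### The Fréchet algebra of entire functions. -/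

namespace EntireFunctions

/-- Locally uniform limits of entire functions are entire, so the subalgebra is closed in the
complete space `C(ℂ, ℂ)`. This is what makes Baire's theorem available. -/
instance instCompleteSpace : CompleteSpace EntireFunctions := by
  have hclosed : IsClosed (EntireFunctions : Set C(ℂ, ℂ)) := by
    refine isClosed_iff_clusterPt.2 fun f hf => ?_
    have : (𝓝 f ⊓ 𝓟 (EntireFunctions : Set C(ℂ, ℂ))).NeBot := hf
    have ht : Tendsto (fun g : C(ℂ, ℂ) => g) (𝓝 f ⊓ 𝓟 (EntireFunctions : Set C(ℂ, ℂ))) (𝓝 f) :=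
      inf_le_left
    rw [ContinuousMap.tendsto_iff_tendstoLocallyUniformly,
      ← tendstoLocallyUniformlyOn_univ] at ht
    have hd : ∀ᶠ g : C(ℂ, ℂ) in 𝓝 f ⊓ 𝓟 (EntireFunctions : Set C(ℂ, ℂ)),
        DifferentiableOn ℂ g Set.univ :=
      eventually_inf_principal.2 (Eventually.of_forall fun g hg =>
        Differentiable.differentiableOn hg)
    exact differentiableOn_univ.1 (ht.differentiableOn hd isOpen_univ)
  exact hclosed.completeSpace_coe

instance instSecondCountableTopology : SecondCountableTopology EntireFunctions :=
  TopologicalSpace.Subtype.secondCountableTopology (EntireFunctions : Set C(ℂ, ℂ))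

instance instIsCountablyGenerated : (𝓤 EntireFunctions).IsCountablyGenerated := by
  have : (𝓤 C(ℂ, ℂ)).IsCountablyGenerated := inferInstance
  exact Filter.comap.isCountablyGenerated _ _

instance instBaireSpace : BaireSpace EntireFunctions := inferInstance

instance instIsTopologicalRing : IsTopologicalRing EntireFunctions :=
  inferInstanceAs (IsTopologicalRing EntireFunctions.toSubring)

instance instIsTopologicalAddGroup : IsTopologicalAddGroup EntireFunctions :=
  instIsTopologicalRing.to_topologicalAddGroup

theorem tendsto_iff {ι : Type*} {l : Filter ι} {F : ι → EntireFunctions} {f : EntireFunctions} :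
    Tendsto F l (𝓝 f) ↔ ∀ R : ℝ, 0 < R → ∀ ε : ℝ, 0 < ε → ∀ᶠ i in l,
      ∀ z : ℂ, ‖z‖ ≤ R → ‖(F i : C(ℂ, ℂ)) z - (f : C(ℂ, ℂ)) z‖ < ε := by
  rw [tendsto_subtype_rng, ContinuousMap.tendsto_iff_forall_isCompact_tendstoUniformlyOn]
  constructor
  · intro h R _ ε hε
    have := Metric.tendstoUniformlyOn_iff.1 (h _ (isCompact_closedBall 0 R)) ε hε
    filter_upwards [this] with i hi z hz
    rw [← dist_eq_norm, dist_comm]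
    exact hi z (by simpa using hz)
  · intro h K hK
    obtain ⟨R, hR, hKR⟩ := hK.isBounded.subset_closedBall_lt 0 0
    refine Metric.tendstoUniformlyOn_iff.2 fun ε hε => ?_
    filter_upwards [h R hR ε hε] with i hi z hz
    rw [dist_comm, dist_eq_norm]
    exact hi z (by simpa using hKR hz)

theorem coe_sum {ι : Type*} (s : Finset ι) (F : ι → EntireFunctions) (z : ℂ) :
    ((∑ i ∈ s, F i : EntireFunctions) : C(ℂ, ℂ)) z = ∑ i ∈ s, (F i : C(ℂ, ℂ)) z := by
  simp

/-- The Weierstrass test in `H(ℂ)`. -/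
theorem hasSum_of_norm_le {ι : Type*} {F : ι → EntireFunctions}
    (h : ∀ R : ℝ, 0 < R → ∃ u : ι → ℝ, Summable u ∧
      ∀ i, ∀ z : ℂ, ‖z‖ ≤ R → ‖(F i : C(ℂ, ℂ)) z‖ ≤ u i) :
    ∃ g : EntireFunctions, HasSum F g ∧ ∀ z, (g : C(ℂ, ℂ)) z = ∑' i, (F i : C(ℂ, ℂ)) z := by
  have hd : Differentiable ℂ fun z => ∑' i, (F i : C(ℂ, ℂ)) z := by
    intro z
    obtain ⟨u, hu, hb⟩ := h (‖z‖ + 1) (by positivity)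
    have := Complex.differentiableOn_tsum_of_summable_norm (F := fun i z => (F i : C(ℂ, ℂ)) z) hu
      (fun i => Differentiable.differentiableOn (F i).2) (Metric.isOpen_ball (x := 0) (ε := ‖z‖ + 1))
      (fun i w hw => hb i w (by simpa using (Metric.mem_ball.1 hw).le))
    exact this.differentiableAt (Metric.isOpen_ball.mem_nhds (by simp))
  refine ⟨⟨⟨_, hd.continuous⟩, hd⟩, ?_, fun z => rfl⟩
  refine tendsto_iff.2 fun R hR ε hε => ?_
  obtain ⟨u, hu, hb⟩ := h R hR
  have := Metric.tendstoUniformlyOn_iff.1 (tendstoUniformlyOn_tsum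
    (f := fun i z => (F i : C(ℂ, ℂ)) z) (s := Metric.closedBall 0 R) hu
    (fun i z hz => hb i z (by simpa using hz))) ε hε
  filter_upwards [this] with s hs z hz
  have := hs z (by simpa using hz)
  rw [dist_comm, dist_eq_norm] at this
  rw [coe_sum]
  exact this

end EntireFunctions

/-! ### Density of exponentials with frequencies on a segment. -/

/-- In a topological algebra whose elements are power series in the derivative `Z` at `0` of a
one-parameter group `E`, the elements `E μ` with `μ` on a segment span a dense subspace. -/
theorem dense_span_oneParameter {X : Type*} [CommRing X] [Algebra ℂ X] [TopologicalSpace X]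
    [IsTopologicalRing X] [ContinuousSMul ℂ X] {E : ℂ → X} {Z : X} (hzero : E 0 = 1)
    (hadd : ∀ μ ν, E (μ + ν) = E μ * E ν)
    (hslope : Tendsto (fun w : ℂ => w⁻¹ • (E w - 1)) (𝓝[≠] 0) (𝓝 Z))
    (htaylor : ∀ f : X, ∃ c : ℕ → ℂ, HasSum (fun n => c n • Z ^ n) f)
    (p v : ℂ) (hv : v ≠ 0) {α β : ℝ} (hαβ : α < β) :
    Dense (Submodule.span ℂ ((fun s : ℝ => E (p + s * v)) '' Set.Ioo α β) : Set X) := by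
  set S := Submodule.span ℂ ((fun s : ℝ => E (p + s * v)) '' Set.Ioo α β)
  -- Differentiating in $s$ brings down a factor $Z$: difference quotients along the segment stay in
  -- the closed span, so by induction $Z^nE(p+sv)$ lies there.
  have hmon : ∀ n : ℕ, ∀ s ∈ Set.Ioo α β,
      Z ^ n * E (p + s * v) ∈ S.topologicalClosure := by
    intro n
    induction n with
    | zero =>
      intro s hs
      rw [pow_zero, one_mul]
      exact S.le_topologicalClosure (Submodule.subset_span ⟨s, hs, rfl⟩)
    | succ n ih =>
      intro s hs
      have hlim : Tendsto (fun h : ℝ => (h * v : ℂ)) (𝓝[≠] 0) (𝓝[≠] 0) := by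
        refine tendsto_nhdsWithin_iff.2 ⟨?_, ?_⟩
        · have : Continuous fun h : ℝ => (h * v : ℂ) := by fun_prop
          exact (this.tendsto' 0 0 (by simp)).mono_left nhdsWithin_le_nhds
        · filter_upwards [self_mem_nhdsWithin] with h hh
          simpa [hv] using hh
      have ht := (hslope.comp hlim).const_mul (Z ^ n * E (p + s * v))
      have e : Z ^ n * E (p + s * v) * Z = Z ^ (n + 1) * E (p + s * v) := by
        ring
      rw [e] at ht
      refine S.isClosed_topologicalClosure.mem_of_tendsto ht ?_
      have hmem : ∀ᶠ h : ℝ in 𝓝[≠] 0, s + h ∈ Set.Ioo α β := by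
        refine nhdsWithin_le_nhds ?_
        have : Continuous fun h : ℝ => s + h := by fun_prop
        exact this.continuousAt.preimage_mem_nhds (isOpen_Ioo.mem_nhds (by simpa using hs))
      filter_upwards [hmem] with h hh
      have e2 : Z ^ n * E (p + s * v) * ((h * v : ℂ)⁻¹ • (E (h * v) - 1))
          = (h * v : ℂ)⁻¹ • (Z ^ n * E (p + (s + h : ℝ) * v)
            - Z ^ n * E (p + s * v)) := by
        have : p + (s + h : ℝ) * v = (p + s * v) + h * v := by
          push_cast
          ring
        rw [mul_smul_comm, mul_sub, mul_one, mul_assoc, ← hadd, this]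
      simp only [Function.comp_apply]
      rw [e2]
      exact S.topologicalClosure.smul_mem _ (Submodule.sub_mem _ (ih _ hh) (ih s hs))
  obtain ⟨s, hs⟩ := Set.nonempty_Ioo.2 hαβ
  intro f
  -- Expanding $f\cdot E(-\mu)$ in powers of $Z$ and multiplying back by $E(\mu)$ writes $f$ as a
  -- limit of combinations of the $Z^nE(\mu)$.
  obtain ⟨c, hc⟩ := htaylor (f * E (-(p + s * v)))
  have hsum := hc.mul_right (E (p + s * v))
  rw [mul_assoc, ← hadd, neg_add_cancel, hzero, mul_one] at hsum
  have : f ∈ S.topologicalClosure := by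
    refine S.isClosed_topologicalClosure.mem_of_tendsto hsum (Eventually.of_forall fun t => ?_)
    refine Submodule.sum_mem _ fun n _ => ?_
    rw [smul_mul_assoc]
    exact Submodule.smul_mem _ _ (hmon n s hs)
  exact this

namespace EntireFunctions

/-- The exponential `z ↦ exp (μ z)` as an element of `H(ℂ)`. -/
noncomputable def expFun (μ : ℂ) : EntireFunctions :=
  ⟨⟨fun z => Complex.exp (μ * z), by fun_prop⟩, by
    change Differentiable ℂ fun z => Complex.exp (μ * z)
    fun_prop⟩

/-- The identity function `z ↦ z` as an element of `H(ℂ)`. -/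
def idFun : EntireFunctions :=
  ⟨⟨fun z => z, by fun_prop⟩, by
    change Differentiable ℂ fun z : ℂ => z
    fun_prop⟩

@[simp] theorem expFun_apply (μ z : ℂ) : (expFun μ : C(ℂ, ℂ)) z = Complex.exp (μ * z) := rfl

@[simp] theorem idFun_apply (z : ℂ) : (idFun : C(ℂ, ℂ)) z = z := rfl

theorem ext_apply {f g : EntireFunctions} (h : ∀ z, (f : C(ℂ, ℂ)) z = (g : C(ℂ, ℂ)) z) : f = g :=
  Subtype.ext (ContinuousMap.ext h)

theorem expFun_zero : expFun 0 = 1 := ext_apply fun z => by simp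

theorem expFun_add (μ ν : ℂ) : expFun (μ + ν) = expFun μ * expFun ν :=
  ext_apply fun z => by simp [add_mul, Complex.exp_add]

theorem exists_norm_le (f : EntireFunctions) (R : ℝ) :
    ∃ M : ℝ, 0 ≤ M ∧ ∀ z : ℂ, ‖z‖ ≤ R → ‖(f : C(ℂ, ℂ)) z‖ ≤ M := by
  obtain ⟨M, hM⟩ := (isCompact_closedBall (0 : ℂ) R).exists_bound_of_continuousOn
    (f := (f : C(ℂ, ℂ))) (by fun_prop)
  exact ⟨max M 0, le_max_right _ _, fun z hz => (hM z (by simpa using hz)).trans (le_max_left _ _)⟩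

theorem entireD_pow_apply (f : EntireFunctions) (n : ℕ) (z : ℂ) :
    (((entireD ^ n) f : EntireFunctions) : C(ℂ, ℂ)) z = iteratedDeriv n (f : C(ℂ, ℂ)) z := by
  induction n generalizing z with
  | zero => simp
  | succ n ih =>
    rw [pow_succ', iteratedDeriv_succ, ← funext ih]
    rfl

theorem norm_iteratedDeriv_le {f : ℂ → ℂ} (hf : Differentiable ℂ f) {R ρ M : ℝ} (hρ : 0 < ρ)
    (hM : ∀ z : ℂ, ‖z‖ ≤ R + ρ → ‖f z‖ ≤ M) {z : ℂ} (hz : ‖z‖ ≤ R) (n : ℕ) :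
    ‖iteratedDeriv n f z‖ ≤ n.factorial * M / ρ ^ n := by
  refine Complex.norm_iteratedDeriv_le_of_forall_mem_sphere_norm_le n hρ hf.diffContOnCl
    fun w hw => hM w ?_
  have h1 : ‖w - z‖ = ρ := by simpa [dist_eq_norm] using hw
  have h2 := norm_add_le (w - z) z
  rw [sub_add_cancel] at h2
  linarith

theorem hasSum_taylor (f : EntireFunctions) :
    HasSum (fun n : ℕ => (iteratedDeriv n (f : C(ℂ, ℂ)) 0 / n.factorial) • idFun ^ n) f := by
  obtain ⟨g, hg, hgz⟩ := hasSum_of_norm_le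
    (F := fun n : ℕ => (iteratedDeriv n (f : C(ℂ, ℂ)) 0 / n.factorial) • idFun ^ n) (by
      intro R hR
      obtain ⟨M, hM0, hM⟩ := exists_norm_le f (0 + 2 * R)
      refine ⟨fun n => M * (1 / 2) ^ n, summable_geometric_two.mul_left M, fun n z hz => ?_⟩
      have h1 := norm_iteratedDeriv_le f.2 (R := 0) (by positivity : 0 < 2 * R) hM (z := 0)
        (by simp) n
      have hn : (0 : ℝ) < n.factorial := by positivity
      have h2 : ‖iteratedDeriv n (f : C(ℂ, ℂ)) 0 / n.factorial‖ ≤ M / (2 * R) ^ n := by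
        rw [norm_div, Complex.norm_natCast, div_le_iff₀ hn]
        calc _ ≤ _ := h1
          _ = _ := by ring
      have h3 : ‖z‖ ^ n ≤ R ^ n := pow_le_pow_left₀ (norm_nonneg _) hz n
      calc _ = ‖iteratedDeriv n (f : C(ℂ, ℂ)) 0 / n.factorial‖ * ‖z‖ ^ n := by
            simp
        _ ≤ M / (2 * R) ^ n * R ^ n := by gcongr
        _ = M * (1 / 2) ^ n := by
            rw [mul_pow, one_div, inv_pow]
            field_simp)
  convert hg using 1
  refine ext_apply fun z => ?_
  rw [hgz, ← Complex.taylorSeries_eq_of_entire f.2 0 z]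
  refine tsum_congr fun n => ?_
  simp
  ring

theorem tendsto_expFun_slope :
    Tendsto (fun w : ℂ => w⁻¹ • (expFun w - 1)) (𝓝[≠] 0) (𝓝 idFun) := by
  refine tendsto_iff.2 fun R hR ε hε => ?_
  -- The first bound gives $|wz|\le1$, where $|e^{wz}-1-wz|\le|wz|^2$; the second makes the quotient
  -- $|w|R^2$ less than $\varepsilon$.
  have h1 : ∀ᶠ w : ℂ in 𝓝[≠] 0, ‖w‖ < min (1 / R) (ε / R ^ 2) := by
    refine nhdsWithin_le_nhds ?_
    have : Tendsto (fun w : ℂ => ‖w‖) (𝓝 0) (𝓝 0) := by simpa using tendsto_norm_zero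
    exact this.eventually_lt_const (by positivity)
  filter_upwards [h1, self_mem_nhdsWithin] with w hw hw0 z hz
  have hw0 : w ≠ 0 := hw0
  have hwp : 0 < ‖w‖ := norm_pos_iff.2 hw0
  have hw1 : ‖w‖ * R < 1 := by
    have := hw.trans_le (min_le_left _ _)
    rwa [lt_div_iff₀ hR] at this
  have hw2 : ‖w‖ * R ^ 2 < ε := by
    have := hw.trans_le (min_le_right _ _)
    rwa [lt_div_iff₀ (by positivity)] at this
  have hwz : ‖w * z‖ ≤ ‖w‖ * R := by
    rw [norm_mul]
    gcongr
  have h3 := Complex.norm_exp_sub_one_sub_id_le (hwz.trans hw1.le)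
  have e : ((w⁻¹ • (expFun w - 1) : EntireFunctions) : C(ℂ, ℂ)) z - (idFun : C(ℂ, ℂ)) z
      = w⁻¹ * (Complex.exp (w * z) - 1 - w * z) := by
    simp
    field_simp
  rw [e, norm_mul, norm_inv]
  calc ‖w‖⁻¹ * ‖Complex.exp (w * z) - 1 - w * z‖ ≤ ‖w‖⁻¹ * (‖w‖ * R) ^ 2 := by
        gcongr
        exact h3.trans (by gcongr)
    _ = ‖w‖ * R ^ 2 := by field_simp
    _ < ε := hw2

/-- Exponentials with frequencies on a segment span a dense subspace of `H(ℂ)`. -/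
theorem dense_span_expFun (p v : ℂ) (hv : v ≠ 0) {α β : ℝ} (hαβ : α < β) :
    Dense (Submodule.span ℂ ((fun s : ℝ => expFun (p + s * v)) '' Set.Ioo α β) :
      Set EntireFunctions) := by
  have h0 := @dense_span_oneParameter EntireFunctions _ _ _ _ _
  have h1 := @h0 expFun idFun expFun_zero expFun_add tendsto_expFun_slope
  exact h1 (fun f => ⟨_, hasSum_taylor f⟩) p v hv hαβ

/-! ### Convolution operators of exponential type. -/

/-- Exponential type estimate: `aₙ Dⁿ f` is dominated geometrically on every disc. -/
theorem exists_norm_convolutionTerm_le {Φ : ℂ → ℂ} (hΦ : Differentiable ℂ Φ) {C B : ℝ}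
    (hb : ∀ z, ‖Φ z‖ ≤ C * Real.exp (B * ‖z‖)) {f : EntireFunctions} {R M : ℝ}
    (hM : ∀ z : ℂ, ‖z‖ ≤ R + 2 * Real.exp B → ‖(f : C(ℂ, ℂ)) z‖ ≤ M) (n : ℕ)
    {z : ℂ} (hz : ‖z‖ ≤ R) :
    ‖(convolutionTerm Φ f n : C(ℂ, ℂ)) z‖ ≤ C * M * (1 / 2) ^ n := by
  have hC : 0 ≤ C := by simpa using (norm_nonneg _).trans (hb 0)
  have h1 : ‖iteratedDeriv n Φ 0‖ ≤ C * Real.exp B ^ n := by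
    rcases Nat.eq_zero_or_pos n with rfl | hn
    · simpa using hb 0
    have hn' : (0 : ℝ) < n := by exact_mod_cast hn
    -- Cauchy's estimate on the circle of radius $n$, chosen so that $n!\le n^n$ cancels the
    -- denominator. For $f$ the radius $2e^B$ then leaves the ratio $1/2$.
    have h2 : ‖iteratedDeriv n Φ 0‖ ≤ n.factorial * (C * Real.exp (B * n)) / (n : ℝ) ^ n := by
      refine Complex.norm_iteratedDeriv_le_of_forall_mem_sphere_norm_le n hn' hΦ.diffContOnCl
        fun w hw => ?_
      have : ‖w‖ = n := by simpa using hw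
      simpa [this] using hb w
    have h3 : (n.factorial : ℝ) ≤ (n : ℝ) ^ n := by exact_mod_cast n.factorial_le_pow
    calc _ ≤ _ := h2
      _ ≤ (n : ℝ) ^ n * (C * Real.exp (B * n)) / (n : ℝ) ^ n := by gcongr
      _ = C * Real.exp (B * n) := by field_simp
      _ = C * Real.exp B ^ n := by rw [mul_comm B, Real.exp_nat_mul]
  have h2 := norm_iteratedDeriv_le f.2 (by positivity : 0 < 2 * Real.exp B) hM hz n
  have e : (convolutionTerm Φ f n : C(ℂ, ℂ)) z
      = iteratedDeriv n Φ 0 / n.factorial * iteratedDeriv n (f : C(ℂ, ℂ)) z := by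
    rw [← entireD_pow_apply]
    rfl
  have hn : (0 : ℝ) < n.factorial := by positivity
  rw [e, norm_mul, norm_div, Complex.norm_natCast]
  calc _ ≤ C * Real.exp B ^ n / n.factorial * (n.factorial * M / (2 * Real.exp B) ^ n) := by
        gcongr
    _ = C * M * (1 / 2) ^ n := by
        rw [mul_pow, one_div, inv_pow]
        field_simp

theorem hasSum_convolutionTerm {Φ : ℂ → ℂ} (hΦ : Differentiable ℂ Φ) {C B : ℝ}
    (hb : ∀ z, ‖Φ z‖ ≤ C * Real.exp (B * ‖z‖)) (f : EntireFunctions) :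
    HasSum (convolutionTerm Φ f) (convolutionOperator Φ f) ∧
      ∀ z, (convolutionOperator Φ f : C(ℂ, ℂ)) z = ∑' n, (convolutionTerm Φ f n : C(ℂ, ℂ)) z := by
  obtain ⟨g, hg, hgz⟩ := hasSum_of_norm_le (F := convolutionTerm Φ f) (fun R _ => by
    obtain ⟨M, -, hM⟩ := exists_norm_le f (R + 2 * Real.exp B)
    exact ⟨fun n => C * M * (1 / 2) ^ n, summable_geometric_two.mul_left _, fun n z hz =>
      exists_norm_convolutionTerm_le hΦ hb hM n hz⟩)
  have e : convolutionOperator Φ f = g := hg.tsum_eq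
  rw [e]
  exact ⟨hg, hgz⟩

theorem exists_convolutionCLM {Φ : ℂ → ℂ} (hΦ : Differentiable ℂ Φ) {C B : ℝ}
    (hb : ∀ z, ‖Φ z‖ ≤ C * Real.exp (B * ‖z‖)) :
    ∃ T : EntireFunctions →L[ℂ] EntireFunctions, ∀ f, T f = convolutionOperator Φ f := by
  have hC : 0 ≤ C := by simpa using (norm_nonneg _).trans (hb 0)
  let L : EntireFunctions →ₗ[ℂ] EntireFunctions :=
    { toFun := convolutionOperator Φ
      map_add' := fun f g => by
        refine HasSum.unique (hasSum_convolutionTerm hΦ hb (f + g)).1 ?_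
        convert (hasSum_convolutionTerm hΦ hb f).1.add (hasSum_convolutionTerm hΦ hb g).1 using 2
        simp [convolutionTerm]
      map_smul' := fun c f => by
        refine HasSum.unique (hasSum_convolutionTerm hΦ hb (c • f)).1 ?_
        have e : convolutionTerm Φ (c • f) = fun n => c • convolutionTerm Φ f n := by
          funext n
          simp only [convolutionTerm, map_smul]
          exact smul_comm _ _ _
        rw [e]
        exact (hasSum_convolutionTerm hΦ hb f).1.const_smul c }
  refine ⟨⟨L, ?_⟩, fun f => rfl⟩
  refine continuous_of_continuousAt_zero L.toAddMonoidHom ?_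
  change Tendsto L (𝓝 0) (𝓝 (L 0))
  rw [map_zero]
  refine tendsto_iff.2 fun R hR ε hε => ?_
  have hid : Tendsto (fun f : EntireFunctions => f) (𝓝 0) (𝓝 0) := tendsto_id
  -- The geometric series sums to $2C\varepsilon'$; the extra $1$ makes the final inequality strict
  -- and allows $C=0$.
  set ε' := ε / (2 * C + 1)
  have hε' : 0 < ε' := by positivity
  filter_upwards [tendsto_iff.1 hid (R + 2 * Real.exp B) (by positivity) ε' hε'] with f hf z hz
  have hterm := fun n => exists_norm_convolutionTerm_le (f := f) (M := ε') hΦ hb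
    (fun w hw => by simpa using (hf w hw).le) n hz
  have hz' : (L f : C(ℂ, ℂ)) z = ∑' n, (convolutionTerm Φ f n : C(ℂ, ℂ)) z :=
    (hasSum_convolutionTerm hΦ hb f).2 z
  have h1 := tsum_of_norm_bounded (hasSum_geometric_two.mul_left (C * ε')) hterm
  rw [hz']
  have h0 : ((0 : EntireFunctions) : C(ℂ, ℂ)) z = 0 := rfl
  rw [h0, sub_zero]
  refine h1.trans_lt ?_
  have : ε' * (2 * C + 1) = ε := div_mul_cancel₀ _ (by positivity)
  nlinarith

/-- Since $D^ne_\mu=\mu^ne_\mu$, the operator series becomes the Taylor series of $\Phi$ evaluated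
at $\mu$. -/
theorem convolutionOperator_expFun {Φ : ℂ → ℂ} (hΦ : Differentiable ℂ Φ) {C B : ℝ}
    (hb : ∀ z, ‖Φ z‖ ≤ C * Real.exp (B * ‖z‖)) (μ : ℂ) :
    convolutionOperator Φ (expFun μ) = Φ μ • expFun μ := by
  refine ext_apply fun z => ?_
  rw [(hasSum_convolutionTerm hΦ hb _).2 z]
  have hD : ∀ n : ℕ, (entireD ^ n) (expFun μ) = μ ^ n • expFun μ := by
    intro n
    induction n with
    | zero => simp
    | succ n ih =>
      have h1 : entireD (expFun μ) = μ • expFun μ := by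
        refine ext_apply fun w => ?_
        change deriv (fun z => Complex.exp (μ * z)) w = μ * Complex.exp (μ * w)
        rw [deriv_cexp (by fun_prop), deriv_const_mul_field]
        simp [mul_comm]
      rw [pow_succ', Module.End.mul_apply, ih, map_smul, h1, smul_smul, ← pow_succ]
  have hs := (Complex.hasSum_taylorSeries_of_entire hΦ 0 μ).mul_right (Complex.exp (μ * z))
  have e : (((Φ μ • expFun μ : EntireFunctions)) : C(ℂ, ℂ)) z = Φ μ * Complex.exp (μ * z) := rfl
  rw [e, ← hs.tsum_eq]
  refine tsum_congr fun n => ?_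
  rw [convolutionTerm, hD]
  simp
  ring

end EntireFunctions

/-! ### Powers of combinations of eigenvectors. -/

theorem prod_eq_apply_sum {M : Type*} [CommMonoid M] {E : ℂ → M} (hzero : E 0 = 1)
    (hadd : ∀ μ ν, E (μ + ν) = E μ * E ν)
    {ι : Type*} (s : Finset ι) (μ : ι → ℂ) : ∏ i ∈ s, E (μ i) = E (∑ i ∈ s, μ i) := by
  classical
  induction s using Finset.induction_on with
  | empty => simp [hzero]
  | insert a s ha ih => rw [Finset.prod_insert ha, Finset.sum_insert ha, ih, hadd]

section Exponentials

variable {X : Type*} [CommRing X] [Algebra ℂ X] [TopologicalSpace X] {E : ℂ → X} {Φ : ℂ → ℂ}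

theorem iterate_apply_eigenvector {T : X →L[ℂ] X} (hT : ∀ μ, T (E μ) = Φ μ • E μ) (n : ℕ) (μ : ℂ) :
    T^[n] (E μ) = Φ μ ^ n • E μ := by
  induction n with
  | zero => simp
  | succ n ih => rw [Function.iterate_succ_apply', ih, map_smul, hT, smul_smul, pow_succ]

/-- Expanding the power over tuples $\kappa$ makes each term an eigenvector with a coefficient
geometric in $n$. Its fate is decided by the modulus of the ratio $\Phi(\sum\mu)\prod q$. -/
theorem iterate_sum_pow (hzero : E 0 = 1) (hadd : ∀ μ ν, E (μ + ν) = E μ * E ν)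
    {T : X →L[ℂ] X} (hT : ∀ μ, T (E μ) = Φ μ • E μ) {ι : Type*} [Fintype ι] (b q μ : ι → ℂ)
    (n j : ℕ) :
    T^[n] ((∑ i, (b i * q i ^ n) • E (μ i)) ^ j) =
      ∑ κ : Fin j → ι, ((∏ i, b (κ i)) * (Φ (∑ i, μ (κ i)) * ∏ i, q (κ i)) ^ n) •
        E (∑ i, μ (κ i)) := by
  rw [Fintype.sum_pow]
  have hsum : ∀ F : (Fin j → ι) → X, T^[n] (∑ κ, F κ) = ∑ κ, T^[n] (F κ) := by
    intro F
    rw [← FunLike.coe_pow_eq_iterate, map_sum]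
  have hsmul : ∀ (c : ℂ) (x : X), T^[n] (c • x) = c • T^[n] x := by
    intro c x
    rw [← FunLike.coe_pow_eq_iterate, map_smul]
  rw [hsum]
  refine Finset.sum_congr rfl fun κ _ => ?_
  have h1 : ∏ i, (b (κ i) * q (κ i) ^ n) • E (μ (κ i)) =
      (∏ i, b (κ i) * q (κ i) ^ n) • ∏ i, E (μ (κ i)) := by
    simp only [Algebra.smul_def, ← Finset.prod_mul_distrib, map_prod]
  rw [h1, prod_eq_apply_sum hzero hadd, hsmul, iterate_apply_eigenvector hT, smul_smul,
    Finset.prod_mul_distrib, mul_pow, Finset.prod_pow]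
  congr 1
  ring

variable [IsTopologicalRing X] [ContinuousSMul ℂ X]

/-- Transitivity for the `m`-th power from eigenvectors `E μ` for the eigenvalues `Φ μ`: small
combinations of `E (lam / m)`, `lam ∈ L`, are added to combinations of `E γ`, `γ ∈ Γ`, and only the
pure `m`-th powers of the former are not contracted. -/
theorem exists_pow_mem_of_eigenvectors (hzero : E 0 = 1) (hadd : ∀ μ ν, E (μ + ν) = E μ * E ν)
    {T : X →L[ℂ] X} (hT : ∀ μ, T (E μ) = Φ μ • E μ) {m : ℕ} (hm : 1 ≤ m) {Γ L : Set ℂ}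
    (hΓ : Dense (Submodule.span ℂ (E '' Γ) : Set X))
    (hL : Dense (Submodule.span ℂ (E '' L) : Set X)) {q : ℂ → ℂ}
    (hq : ∀ lam ∈ L, q lam ^ m * Φ lam = 1) (hq1 : ∀ lam ∈ L, ‖q lam‖ < 1)
    (hcontr : ∀ j, 1 ≤ j → j ≤ m → ∀ κ : Fin j → ℂ ⊕ ℂ,
      (∀ i, Sum.elim (· ∈ Γ) (· ∈ L) (κ i)) → (j = m → ¬ ∃ lam, ∀ i, κ i = Sum.inr lam) →
      ‖Φ (∑ i, Sum.elim id (· / (m : ℂ)) (κ i)) * ∏ i, Sum.elim 1 q (κ i)‖ < 1)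
    {U V W : Set X} (hU : IsOpen U) (hUne : U.Nonempty) (hV : IsOpen V) (hVne : V.Nonempty)
    (hW : IsOpen W) (hW0 : (0 : X) ∈ W) :
    ∃ f ∈ U, ∃ n : ℕ, T^[n] (f ^ m) ∈ V ∧ ∀ j, 1 ≤ j → j < m → T^[n] (f ^ j) ∈ W := by
  classical
  obtain ⟨g, hgU, hg⟩ := hΓ.inter_open_nonempty U hU hUne
  obtain ⟨h, hhV, hh⟩ := hL.inter_open_nonempty V hV hVne
  obtain ⟨α, hα, rfl⟩ := (Finsupp.mem_span_image_iff_linearCombination ℂ).1 hg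
  obtain ⟨β, hβ, rfl⟩ := (Finsupp.mem_span_image_iff_linearCombination ℂ).1 hh
  rw [Finsupp.mem_supported] at hα hβ
  rw [Finsupp.linearCombination_apply, Finsupp.sum, ← Finset.sum_coe_sort] at hgU hhV
  have hroot : ∀ lam, ∃ c : ℂ, c ^ m = β lam := fun lam => IsAlgClosed.exists_pow_nat_eq _ hm
  choose c hc using hroot
  let ι := α.support ⊕ β.support
  let e : ι → ℂ ⊕ ℂ := Sum.map Subtype.val Subtype.val
  let b : ι → ℂ := fun i => Sum.elim α c (e i)
  let Q : ι → ℂ := fun i => Sum.elim 1 q (e i)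
  let μ : ι → ℂ := fun i => Sum.elim id (· / (m : ℂ)) (e i)
  have he : ∀ i, Sum.elim (· ∈ Γ) (· ∈ L) (e i) := by
    rintro (i | i)
    · exact hα i.2
    · exact hβ i.2
  let F : ℕ → X := fun n => ∑ i, (b i * Q i ^ n) • E (μ i)
  have hF : Tendsto F atTop (𝓝 (∑ i : α.support, α i • E i)) := by
    have hsplit : ∀ n, F n = ∑ i : α.support, α i • E i +
        ∑ i : β.support, (c i * q i ^ n) • E (i / (m : ℂ)) := by
      intro n
      simp only [F, ι, Fintype.sum_sum_type]
      simp [b, Q, μ, e]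
    rw [show F = _ from funext hsplit]
    have hz : ∑ i : α.support, α i • E i = ∑ i : α.support, α i • E i +
        ∑ i : β.support, (c i * 0) • E (i / (m : ℂ)) := by simp
    nth_rewrite 2 [hz]
    refine tendsto_const_nhds.add (tendsto_finsetSum _ fun i _ => ?_)
    exact ((tendsto_pow_atTop_nhds_zero_of_norm_lt_one (hq1 i (hβ i.2))).const_mul _).smul_const _
  have hterm : ∀ j, 1 ≤ j → j ≤ m → ∀ κ : Fin j → ι,
      (j = m → ¬ ∃ lam : β.support, (fun _ => Sum.inr lam) = κ) →
      Tendsto (fun n : ℕ => ((∏ i, b (κ i)) * (Φ (∑ i, μ (κ i)) * ∏ i, Q (κ i)) ^ n) •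
        E (∑ i, μ (κ i))) atTop (𝓝 0) := by
    intro j hj hjm κ hκ
    have hlt : ‖Φ (∑ i, μ (κ i)) * ∏ i, Q (κ i)‖ < 1 := by
      refine hcontr j hj hjm (fun i => e (κ i)) (fun i => he _) ?_
      rintro rfl ⟨lam, hlam⟩
      have hι : ∀ i : ι, e i = Sum.inr lam → ∃ x : β.support, x = lam ∧ i = Sum.inr x := by
        rintro (i | i) hi
        · simp [e] at hi
        · exact ⟨i, by simpa [e] using hi, rfl⟩
      obtain ⟨x, hx, -⟩ := hι _ (hlam ⟨0, hj⟩)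
      refine hκ rfl ⟨x, funext fun i => ?_⟩
      obtain ⟨y, hy, hyi⟩ := hι _ (hlam i)
      rw [hyi, Subtype.ext (hx.trans hy.symm)]
    have := ((tendsto_pow_atTop_nhds_zero_of_norm_lt_one hlt).const_mul
      (∏ i, b (κ i))).smul_const (E (∑ i, μ (κ i)))
    simpa using this
  have hsmall : ∀ j ∈ Finset.Ico 1 m, Tendsto (fun n => T^[n] (F n ^ j)) atTop (𝓝 0) := by
    intro j hj
    rw [Finset.mem_Ico] at hj
    simp only [F, iterate_sum_pow hzero hadd hT]
    have := tendsto_finsetSum (Finset.univ : Finset (Fin j → ι)) fun κ _ =>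
      hterm j hj.1 hj.2.le κ fun h => absurd h hj.2.ne
    simpa using this
  have hbig : Tendsto (fun n => T^[n] (F n ^ m)) atTop (𝓝 (∑ i : β.support, β i • E i)) := by
    simp only [F, iterate_sum_pow hzero hadd hT]
    let D : β.support → Fin m → ι := fun lam _ => Sum.inr lam
    have hD : Function.Injective D := fun x y hxy => by
      have := congrFun hxy ⟨0, hm⟩
      exact Sum.inr_injective this
    -- Termwise limits of the expansion: constant tuples $\lambda$ have ratio exactly $1$ and
    -- contribute $c_\lambda^mE(\lambda)$; all others vanish.
    let G : (Fin m → ι) → X := fun κ =>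
      if κ ∈ Set.range D then (∏ i, b (κ i)) • E (∑ i, μ (κ i)) else 0
    have hm0 : (m : ℂ) ≠ 0 := by exact_mod_cast (by omega : m ≠ 0)
    have hG : ∑ i : β.support, β i • E i = ∑ κ, G κ := by
      refine Fintype.sum_of_injective D hD _ _ (fun κ hκ => if_neg hκ) fun lam => ?_
      simp only [G, if_pos (Set.mem_range_self lam)]
      simp [D, b, μ, e, hc, mul_div_cancel₀ _ hm0]
    rw [hG]
    refine tendsto_finsetSum _ fun κ _ => ?_
    by_cases hκ : κ ∈ Set.range D
    · simp only [G, if_pos hκ]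
      obtain ⟨lam, rfl⟩ := hκ
      have h1 : Φ (∑ i, μ (D lam i)) * ∏ i, Q (D lam i) = 1 := by
        have := hq lam (hβ lam.2)
        rw [mul_comm] at this
        simpa [D, Q, μ, e, mul_div_cancel₀ _ hm0] using this
      simp only [h1, one_pow, mul_one]
      exact tendsto_const_nhds
    · simp only [G, if_neg hκ]
      exact hterm m hm le_rfl κ fun _ hex => hκ hex
  have hev := (hF.eventually (hU.mem_nhds hgU)).and ((hbig.eventually (hV.mem_nhds hhV)).and
    ((Filter.eventually_all_finset _).2 fun j hj => (hsmall j hj).eventually (hW.mem_nhds hW0)))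
  obtain ⟨n, hn1, hn2, hn3⟩ := hev.exists
  exact ⟨F n, hn1, n, hn2, fun j hj hjm => hn3 j (Finset.mem_Ico.2 ⟨hj, hjm⟩)⟩

end Exponentials

/-! ### Growth and the Phragmén–Lindelöf principle. -/

/-- Growth `(1/2, 0)` means `|φ(z)| ≤ C_ε exp (ε |z|^{1/2})` for every `ε > 0`. -/
theorem IsOfGrowth.exists_norm_le {φ : ℂ → ℂ} (hφ : Differentiable ℂ φ)
    (hnonconst : ¬ ∃ c, ∀ z, φ z = c) (hgrowth : IsOfGrowth φ (1 / 2) 0) {ε : ℝ} (hε : 0 < ε) :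
    ∃ C : ℝ, ∀ z, ‖φ z‖ ≤ C * Real.exp (ε * √‖z‖) := by
  have hord : growthOrder φ = Filter.limsup
      (fun r : ℝ => ((Real.log (Real.log (maxModulus φ r)) / Real.log r : ℝ) : EReal))
      Filter.atTop := if_neg hnonconst
  have hlog : ∀ᶠ r : ℝ in atTop, Real.log (maxModulus φ r) ≤ ε * √r := by
    rcases hgrowth with hlt | ⟨heq, htype⟩
    · obtain ⟨s, hs1, hs2⟩ := EReal.lt_iff_exists_real_btwn.1 hlt
      have hs2 : s < 1 / 2 := by exact_mod_cast hs2
      rw [hord] at hs1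
      have h1 := eventually_lt_of_limsup_lt hs1
      have h2 : ∀ᶠ r : ℝ in atTop, ε⁻¹ ≤ r ^ (1 / 2 - s) :=
        (tendsto_rpow_atTop (by linarith)).eventually_ge_atTop _
      filter_upwards [h1, h2, eventually_gt_atTop 1] with r hr1 hr2 hr
      have hr0 : (0 : ℝ) < r := by linarith
      have hr1 : Real.log (Real.log (maxModulus φ r)) / Real.log r < s := by exact_mod_cast hr1
      -- The iterated logarithm carries the expected information only when $\log M(r)>0$; otherwise
      -- the bound is trivial.
      rcases le_or_gt (Real.log (maxModulus φ r)) 0 with h0 | h0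
      · exact h0.trans (by positivity)
      have h3 : Real.log (maxModulus φ r) < r ^ s := by
        rw [div_lt_iff₀ (Real.log_pos hr)] at hr1
        rw [← Real.log_lt_log_iff h0 (by positivity), Real.log_rpow hr0]
        exact hr1
      have h4 : √r = r ^ (1 / 2 - s) * r ^ s := by
        rw [← Real.rpow_add hr0, Real.sqrt_eq_rpow]
        congr 1
        ring
      have h5 : 1 ≤ ε * r ^ (1 / 2 - s) := by
        have := mul_le_mul_of_nonneg_left hr2 hε.le
        rwa [mul_inv_cancel₀ hε.ne'] at this
      have h6 : 0 < r ^ s := by positivity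
      rw [h4]
      nlinarith
    · have h0 : growthType φ < (ε : EReal) := htype.trans_lt (by exact_mod_cast hε)
      have h1 := eventually_lt_of_limsup_lt h0
      filter_upwards [h1, eventually_gt_atTop 0] with r hr1 hr
      have hr1 : r ^ (-(growthOrder φ).toReal) * Real.log (maxModulus φ r) < ε := by
        exact_mod_cast hr1
      rw [heq, EReal.toReal_coe, Real.rpow_neg hr.le, ← Real.sqrt_eq_rpow,
        inv_mul_lt_iff₀ (Real.sqrt_pos.2 hr)] at hr1
      linarith
  have hbdd : ∀ r : ℝ, ∀ z : ℂ, ‖z‖ ≤ r → ‖φ z‖ ≤ maxModulus φ r := by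
    intro r z hz
    refine le_csSup ?_ ⟨z, by simpa using hz, rfl⟩
    exact ((isCompact_closedBall (0 : ℂ) r).image hφ.continuous.norm).bddAbove
  obtain ⟨r₀, hr₀⟩ := eventually_atTop.1 hlog
  refine ⟨max 1 (maxModulus φ r₀), fun z => ?_⟩
  have hexp : 1 ≤ Real.exp (ε * √‖z‖) := Real.one_le_exp (by positivity)
  rcases le_total ‖z‖ r₀ with hz | hz
  · have h1 := hbdd r₀ z hz
    have h2 := le_max_right 1 (maxModulus φ r₀)
    have h3 : 0 ≤ max 1 (maxModulus φ r₀) := zero_le_one.trans (le_max_left _ _)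
    nlinarith
  · have h1 := hbdd ‖z‖ z le_rfl
    have h2 : maxModulus φ ‖z‖ ≤ Real.exp (ε * √‖z‖) := by
      rcases le_or_gt (maxModulus φ ‖z‖) 0 with h0 | h0
      · exact h0.trans (Real.exp_pos _).le
      · exact (Real.log_le_iff_le_exp h0).1 (hr₀ _ hz)
    have h3 := le_max_left 1 (maxModulus φ r₀)
    nlinarith

/-- An entire function of growth `(1/2, 0)` which is bounded on a ray is constant. -/
theorem exists_eq_const_of_bounded_on_ray {φ : ℂ → ℂ} (hφ : Differentiable ℂ φ)
    (hb : ∀ ε : ℝ, 0 < ε → ∃ C : ℝ, ∀ z, ‖φ z‖ ≤ C * Real.exp (ε * √‖z‖)) {w : ℂ} (hw : w ≠ 0)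
    {M : ℝ} (hM : ∀ t : ℝ, 0 ≤ t → ‖φ (t * w)‖ ≤ M) : ∃ c, ∀ z, φ z = c := by
  -- The map $\zeta\mapsto-\zeta^2w$ takes the imaginary axis to the ray, where $\varphi$ is
  -- bounded, and turns growth $(1/2,0)$ into exponential type zero on the right half-plane. The
  -- factor $e^{-\varepsilon\zeta}$ forces decay on the positive axis and has modulus $1$ on the
  -- boundary.
  have hstep : ∀ ζ : ℂ, 0 ≤ ζ.re → ‖φ (-(ζ ^ 2 * w))‖ ≤ M := by
    intro ζ hζ
    have hε : ∀ ε : ℝ, 0 < ε → ‖φ (-(ζ ^ 2 * w)) * Complex.exp (-(ε * ζ))‖ ≤ M := by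
      intro ε hε
      have hsw : 0 < √‖w‖ := Real.sqrt_pos.2 (norm_pos_iff.2 hw)
      -- This constant gives growth $e^{\varepsilon|\xi|/2}$ after the substitution, half of what
      -- the damping factor removes on the real axis.
      obtain ⟨C, hC⟩ := hb (ε / 2 / √‖w‖) (by positivity)
      have hC0 : 0 ≤ C := by simpa using (norm_nonneg _).trans (hC 0)
      have hC' : ∀ ξ : ℂ, ‖φ (-(ξ ^ 2 * w))‖ ≤ C * Real.exp (ε / 2 * ‖ξ‖) := by
        intro ξ
        have := hC (-(ξ ^ 2 * w))
        rwa [norm_neg, norm_mul, norm_pow, Real.sqrt_mul (by positivity),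
          Real.sqrt_sq (norm_nonneg _), mul_comm ‖ξ‖, ← mul_assoc,
          div_mul_cancel₀ _ hsw.ne'] at this
      have hd : Differentiable ℂ fun ξ : ℂ => φ (-(ξ ^ 2 * w)) * Complex.exp (-(ε * ξ)) := by
        fun_prop
      have hn : ∀ ξ : ℂ, ‖Complex.exp (-(ε * ξ))‖ = Real.exp (-(ε * ξ.re)) := by
        intro ξ
        rw [Complex.norm_exp]
        simp
      refine PhragmenLindelof.right_half_plane_of_tendsto_zero_on_real
        (f := fun ξ : ℂ => φ (-(ξ ^ 2 * w)) * Complex.exp (-(ε * ξ))) hd.diffContOnCl ?_ ?_ ?_ hζ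
      · refine ⟨1, by norm_num, ε / 2, ?_⟩
        refine Asymptotics.IsBigO.of_bound C ?_
        refine eventually_inf_principal.2 (Eventually.of_forall fun ξ hξ => ?_)
        have hξ : 0 < ξ.re := hξ
        rw [norm_mul, hn, Real.rpow_one, Real.norm_of_nonneg (Real.exp_pos _).le]
        have h1 : Real.exp (-(ε * ξ.re)) ≤ 1 := Real.exp_le_one_iff.2 (by
          have := mul_pos hε hξ
          linarith)
        calc _ ≤ ‖φ (-(ξ ^ 2 * w))‖ * 1 := by gcongr
          _ ≤ _ := by simpa using hC' ξ
      · have h1 : Tendsto (fun x : ℝ => C * Real.exp (-(ε / 2 * x))) atTop (𝓝 0) := by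
          have h2 : Tendsto (fun x : ℝ => ε / 2 * x) atTop atTop :=
            tendsto_id.const_mul_atTop (by positivity)
          simpa using (Real.tendsto_exp_neg_atTop_nhds_zero.comp h2).const_mul C
        refine squeeze_zero_norm' ?_ h1
        filter_upwards [eventually_ge_atTop 0] with x hx
        rw [norm_mul, hn]
        have h3 := hC' x
        rw [Complex.norm_real, Real.norm_of_nonneg hx] at h3
        calc _ ≤ C * Real.exp (ε / 2 * x) * Real.exp (-(ε * x)) := by
              rw [Complex.ofReal_re]
              gcongr
          _ = C * Real.exp (-(ε / 2 * x)) := by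
              rw [mul_assoc, ← Real.exp_add]
              congr 2
              ring
      · intro x
        have h1 : -((x * Complex.I) ^ 2 * w) = ((x ^ 2 : ℝ) : ℂ) * w := by
          rw [mul_pow, Complex.I_sq]
          push_cast
          ring
        rw [norm_mul, hn, h1]
        have h2 : Real.exp (-(ε * (x * Complex.I).re)) = 1 := by simp
        rw [h2, mul_one]
        exact hM (x ^ 2) (by positivity)
    have hlim : Tendsto (fun ε : ℝ => ‖φ (-(ζ ^ 2 * w)) * Complex.exp (-(ε * ζ))‖) (𝓝[>] 0)
        (𝓝 ‖φ (-(ζ ^ 2 * w))‖) := by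
      have hc : Continuous fun ε : ℝ => ‖φ (-(ζ ^ 2 * w)) * Complex.exp (-(ε * ζ))‖ := by
        fun_prop
      exact (hc.tendsto' 0 _ (by simp)).mono_left nhdsWithin_le_nhds
    exact le_of_tendsto hlim (by
      filter_upwards [self_mem_nhdsWithin] with ε hε' using hε ε hε')
  have hall : ∀ z, ‖φ z‖ ≤ M := by
    intro z
    obtain ⟨ζ, hζ⟩ := IsAlgClosed.exists_pow_nat_eq (-(z / w)) (n := 2) (by norm_num)
    have hz : -(ζ ^ 2 * w) = z := by
      rw [hζ]
      field_simp
    rcases le_total 0 ζ.re with h | h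
    · simpa [hz] using hstep ζ h
    · have := hstep (-ζ) (by simpa using h)
      rwa [neg_sq, hz] at this
  refine ⟨φ 0, fun z => hφ.apply_eq_apply_of_bounded ?_ z 0⟩
  refine (Metric.isBounded_closedBall (x := (0 : ℂ)) (r := M)).subset ?_
  rintro _ ⟨z, rfl⟩
  simpa using hall z

/-! ### Strict convexity of `log |Φ|` along segments. -/

/-- Where the logarithmic derivative of `Φ` has non-zero derivative, `log |Φ|` is strictly convex
along some segment. -/
theorem exists_strictConvexOn_log_norm {Φ : ℂ → ℂ} (hΦ : Differentiable ℂ Φ) {p : ℂ}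
    (hp : Φ p ≠ 0) (hne : Φ p * deriv (deriv Φ) p ≠ deriv Φ p ^ 2) :
    ∃ v : ℂ, v ≠ 0 ∧ ∀ᶠ δ : ℝ in 𝓝[>] 0,
      StrictConvexOn ℝ (Set.Ioo (-δ) δ) fun s : ℝ => Real.log ‖Φ (p + s * v)‖ := by
  have hΦ' : Differentiable ℂ (deriv Φ) :=
    differentiableOn_univ.1 (hΦ.differentiableOn.deriv isOpen_univ)
  have hΦ'' : Differentiable ℂ (deriv (deriv Φ)) :=
    differentiableOn_univ.1 (hΦ'.differentiableOn.deriv isOpen_univ)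
  have c0 := hΦ.continuous
  have c1 := hΦ'.continuous
  have c2 := hΦ''.continuous
  -- $N=(\Phi'/\Phi)'$, so the second derivative of $s\mapsto\log|\Phi(p+sv)|$ is
  -- $\operatorname{Re}(N v^2)$. Choosing $v^2=N(p)^{-1}$ makes it $1$ at $s=0$.
  let N : ℂ → ℂ := fun z => (Φ z * deriv (deriv Φ) z - deriv Φ z ^ 2) / Φ z ^ 2
  have hNp : N p ≠ 0 := div_ne_zero (sub_ne_zero.2 hne) (pow_ne_zero _ hp)
  obtain ⟨v, hv⟩ := IsAlgClosed.exists_pow_nat_eq (N p)⁻¹ (n := 2) (by norm_num)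
  have hNv : N p * v ^ 2 = 1 := by rw [hv, mul_inv_cancel₀ hNp]
  have hv0 : v ≠ 0 := by
    rintro rfl
    simp at hNv
  refine ⟨v, hv0, ?_⟩
  have hline : Tendsto (fun s : ℝ => p + s * v) (𝓝 0) (𝓝 p) := by
    have : Continuous fun s : ℝ => p + s * v := by fun_prop
    exact this.tendsto' 0 p (by simp)
  -- Normalising by $\Phi(p)$ puts the values near $1$, where the principal logarithm is
  -- holomorphic.
  have hslit : ∀ᶠ s : ℝ in 𝓝 0, Φ (p + s * v) / Φ p ∈ Complex.slitPlane := by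
    have : ContinuousAt (fun z => Φ z / Φ p) p := by fun_prop
    exact hline.eventually (this.preimage_mem_nhds
      (Complex.isOpen_slitPlane.mem_nhds (by simp [div_self hp])))
  have hpos : ∀ᶠ s : ℝ in 𝓝 0, 0 < (N (p + s * v) * v ^ 2).re := by
    have h1 : ContinuousAt (fun z => (N z * v ^ 2).re) p := by
      have : ContinuousAt N p := by
        refine ContinuousAt.div ?_ ?_ (pow_ne_zero _ hp) <;> fun_prop
      exact Complex.continuous_re.continuousAt.comp (this.mul continuousAt_const)
    exact hline.eventually (h1.eventually (lt_mem_nhds (by simp [hNv])))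
  obtain ⟨δ₀, hδ₀, hδ⟩ := Metric.eventually_nhds_iff.1 (hslit.and hpos)
  filter_upwards [Ioo_mem_nhdsGT hδ₀] with δ hδlt
  have hmem : ∀ s ∈ Set.Ioo (-δ) δ, Φ (p + s * v) / Φ p ∈ Complex.slitPlane ∧
      0 < (N (p + s * v) * v ^ 2).re := by
    intro s hs
    refine hδ ?_
    rw [Real.dist_eq, sub_zero, abs_lt]
    exact ⟨by linarith [hs.1, hδlt.2], by linarith [hs.2, hδlt.2]⟩
  have hne0 : ∀ s ∈ Set.Ioo (-δ) δ, Φ (p + s * v) ≠ 0 := by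
    intro s hs h0
    have := (hmem s hs).1
    rw [h0, zero_div] at this
    exact Complex.zero_notMem_slitPlane this
  have hlin : ∀ x : ℂ, HasDerivAt (fun x : ℂ => p + x * v) v x := fun x => by
    simpa using ((hasDerivAt_id x).mul_const v).const_add p
  have hD : ∀ (f : ℂ → ℂ), Differentiable ℂ f → ∀ x : ℂ,
      HasDerivAt (fun x : ℂ => f (p + x * v)) (deriv f (p + x * v) * v) x := fun f hf x =>
    (hf (p + x * v)).hasDerivAt.comp x (hlin x)
  have hfirst : ∀ s ∈ Set.Ioo (-δ) δ, HasDerivAt (fun s : ℝ => Real.log ‖Φ (p + s * v)‖)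
      (deriv Φ (p + s * v) * v / Φ (p + s * v)).re s := by
    intro s hs
    have h1 : HasDerivAt (fun x : ℂ => Complex.log (Φ (p + x * v) / Φ p))
        (deriv Φ (p + s * v) * v / Φ (p + s * v)) (s : ℂ) := by
      refine (((hD Φ hΦ s).div_const (Φ p)).clog (hmem s hs).1).congr_deriv ?_
      have := hne0 s hs
      field_simp
    have h2 := h1.real_of_complex.add_const (Real.log ‖Φ p‖)
    refine h2.congr_of_eventuallyEq ?_
    filter_upwards [isOpen_Ioo.mem_nhds hs] with x hx
    rw [Complex.log_re, norm_div, Real.log_div (norm_ne_zero_iff.2 (hne0 x hx))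
      (norm_ne_zero_iff.2 hp), sub_add_cancel]
  refine strictConvexOn_of_deriv2_pos (convex_Ioo _ _)
    (fun s hs => (hfirst s hs).continuousAt.continuousWithinAt) fun s hs => ?_
  rw [interior_Ioo] at hs
  have h1 : HasDerivAt (fun x : ℂ => deriv Φ (p + x * v) * v / Φ (p + x * v))
      (N (p + s * v) * v ^ 2) (s : ℂ) := by
    refine (((hD (deriv Φ) hΦ' s).mul_const v).div (hD Φ hΦ s) (hne0 s hs)).congr_deriv ?_
    change _ = (_ - _) / _ * _
    ring
  have h2 : deriv (fun s : ℝ => Real.log ‖Φ (p + s * v)‖) =ᶠ[𝓝 s]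
      fun s : ℝ => (deriv Φ (p + s * v) * v / Φ (p + s * v)).re := by
    filter_upwards [isOpen_Ioo.mem_nhds hs] with x hx using (hfirst x hx).deriv
  rw [Function.iterate_succ_apply, Function.iterate_one, h2.deriv_eq, h1.real_of_complex.deriv]
  exact (hmem s hs).2

/-- If the logarithmic derivative of an entire function is locally constant on some non-empty open
set then the function is an exponential. -/
theorem eq_exp_of_logDeriv_locally_const {Φ : ℂ → ℂ} (hΦ : Differentiable ℂ Φ) (h0 : Φ 0 ≠ 0)
    {U : Set ℂ} (hU : IsOpen U) (hUne : U.Nonempty)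
    (h : ∀ z ∈ U, Φ z * deriv (deriv Φ) z = deriv Φ z ^ 2) :
    ∃ c, ∀ z, Φ z = Φ 0 * Complex.exp (c * z) := by
  have hΦ' : Differentiable ℂ (deriv Φ) :=
    differentiableOn_univ.1 (hΦ.differentiableOn.deriv isOpen_univ)
  have hΦ'' : Differentiable ℂ (deriv (deriv Φ)) :=
    differentiableOn_univ.1 (hΦ'.differentiableOn.deriv isOpen_univ)
  have han : ∀ f : ℂ → ℂ, Differentiable ℂ f → AnalyticOnNhd ℂ f Set.univ := fun f hf =>
    hf.differentiableOn.analyticOnNhd isOpen_univ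
  obtain ⟨u, hu⟩ := hUne
  have hall : ∀ z, Φ z * deriv (deriv Φ) z = deriv Φ z ^ 2 := fun z =>
    (han _ (hΦ.mul hΦ'')).eqOn_of_preconnected_of_eventuallyEq (han _ (hΦ'.pow 2))
      isPreconnected_univ (Set.mem_univ u) (by
        filter_upwards [hU.mem_nhds hu] with z hz using h z hz) (Set.mem_univ z)
  obtain ⟨r, hr, hball⟩ := Metric.eventually_nhds_iff_ball.1
    (hΦ.continuous.continuousAt.eventually_ne h0)
  have hq : ∀ z ∈ Metric.ball (0 : ℂ) r, HasDerivAt (fun z => deriv Φ z / Φ z) 0 z := by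
    intro z hz
    refine ((hΦ' z).hasDerivAt.div (hΦ z).hasDerivAt (hball z hz)).congr_deriv ?_
    rw [div_eq_zero_iff]
    left
    linear_combination hall z
  set c := deriv Φ 0 / Φ 0 with hc
  have hconst : ∀ z ∈ Metric.ball (0 : ℂ) r, deriv Φ z = c * Φ z := by
    intro z hz
    have := Metric.isOpen_ball.is_const_of_deriv_eq_zero
      (convex_ball (0 : ℂ) r).isPreconnected
      (fun z hz => (hq z hz).differentiableAt.differentiableWithinAt)
      (fun z hz => (hq z hz).deriv) hz (Metric.mem_ball_self hr)
    rw [hc, ← this, div_mul_cancel₀ _ (hball z hz)]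
  have hode : ∀ z, deriv Φ z = c * Φ z := fun z =>
    (han _ hΦ').eqOn_of_preconnected_of_eventuallyEq (han _ (hΦ.const_mul c))
      isPreconnected_univ (Set.mem_univ 0) (by
        filter_upwards [Metric.isOpen_ball.mem_nhds (Metric.mem_ball_self hr)] with z hz
          using hconst z hz) (Set.mem_univ z)
  have hder : ∀ z, HasDerivAt (fun z => Φ z * Complex.exp (-(c * z))) 0 z := by
    intro z
    have h1 : HasDerivAt (fun z => -(c * z)) (-c) z := by
      exact (((hasDerivAt_id z).const_mul c).neg).congr_deriv (by simp)
    refine ((hΦ z).hasDerivAt.mul h1.cexp).congr_deriv ?_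
    rw [hode z]
    ring
  refine ⟨c, fun z => ?_⟩
  have h2 := is_const_of_deriv_eq_zero (fun z => (hder z).differentiableAt)
    (fun z => (hder z).deriv) z 0
  simp only [mul_zero, neg_zero, Complex.exp_zero, mul_one] at h2
  rw [← h2, mul_assoc, ← Complex.exp_add, neg_add_cancel, Complex.exp_zero, mul_one]

/-- Near a point where `1 ≤ |Φ|` there is a segment in `{1 < |Φ|}` on which `log |Φ|` is strictly
convex. -/
theorem exists_segment_strictConvexOn {Φ : ℂ → ℂ} (hΦ : Differentiable ℂ Φ)
    (hnl : ∀ U : Set ℂ, IsOpen U → U.Nonempty →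
      ∃ p ∈ U, Φ p * deriv (deriv Φ) p ≠ deriv Φ p ^ 2)
    {U : Set ℂ} (hU : IsOpen U) {p₀ : ℂ} (hp₀ : p₀ ∈ U) (h1 : 1 ≤ ‖Φ p₀‖) :
    ∃ p v : ℂ, v ≠ 0 ∧ ∃ δ : ℝ, 0 < δ ∧
      (∀ s ∈ Set.Ioo (-δ) δ, p + s * v ∈ U ∧ 1 < ‖Φ (p + s * v)‖) ∧
      StrictConvexOn ℝ (Set.Ioo (-δ) δ) fun s : ℝ => Real.log ‖Φ (p + s * v)‖ := by
  have hopen : IsOpen (U ∩ {z | 1 < ‖Φ z‖}) :=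
    hU.inter (isOpen_lt continuous_const hΦ.continuous.norm)
  have hne : (U ∩ {z | 1 < ‖Φ z‖}).Nonempty := by
    -- Otherwise $p_0$ is a local maximum of $|\Phi|$, so $\Phi$ is locally constant by the maximum
    -- principle, which the nondegeneracy hypothesis excludes.
    by_contra hemp
    have hle : ∀ z ∈ U, ‖Φ z‖ ≤ 1 := fun z hz => not_lt.1 fun hlt => hemp ⟨z, hz, hlt⟩
    have hmax : IsLocalMax (norm ∘ Φ) p₀ := by
      filter_upwards [hU.mem_nhds hp₀] with z hz using (hle z hz).trans h1
    have hev := Complex.eventually_eq_of_isLocalMax_norm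
      (Eventually.of_forall fun z => hΦ z) hmax
    obtain ⟨V, hV, hVo, hpV⟩ := eventually_nhds_iff.1 hev
    obtain ⟨p, hp, hpne⟩ := hnl V hVo ⟨p₀, hpV⟩
    have hd : ∀ z ∈ V, deriv Φ z = 0 := by
      intro z hz
      have : Φ =ᶠ[𝓝 z] fun _ => Φ p₀ := by
        filter_upwards [hVo.mem_nhds hz] with y hy using hV y hy
      rw [this.deriv_eq, deriv_const]
    have hd2 : deriv (deriv Φ) p = 0 := by
      have : deriv Φ =ᶠ[𝓝 p] fun _ => 0 := by
        filter_upwards [hVo.mem_nhds hp] with y hy using hd y hy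
      rw [this.deriv_eq, deriv_const]
    exact hpne (by rw [hd2, hd p hp]; ring)
  obtain ⟨p, hp, hpne⟩ := hnl _ hopen hne
  have hp1 : 1 < ‖Φ p‖ := hp.2
  have hp0 : Φ p ≠ 0 := norm_pos_iff.1 (zero_lt_one.trans hp1)
  obtain ⟨v, hv, hconv⟩ := exists_strictConvexOn_log_norm hΦ hp0 hpne
  have hline : Tendsto (fun s : ℝ => p + s * v) (𝓝 0) (𝓝 p) := by
    have : Continuous fun s : ℝ => p + s * v := by fun_prop
    exact this.tendsto' 0 p (by simp)
  obtain ⟨δ₀, hδ₀, hδ⟩ := Metric.eventually_nhds_iff.1 (hline.eventually (hopen.mem_nhds hp))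
  obtain ⟨δ, hc, hδpos, hδlt⟩ := (hconv.and (Ioo_mem_nhdsGT hδ₀)).exists
  refine ⟨p, v, hv, δ, hδpos, fun s hs => hδ ?_, hc⟩
  rw [Real.dist_eq, sub_zero, abs_lt]
  exact ⟨by linarith [hs.1], by linarith [hs.2]⟩

/-- On a segment of strict convexity of `log |Φ|`, products of distinct `m`-th roots of the
`1 / Φ lam` beat the value of `Φ` at the barycentre. -/
theorem norm_mul_prod_root_lt_one {Φ : ℂ → ℂ} {p v : ℂ} {δ : ℝ} {m : ℕ} (hm : 1 ≤ m)
    (h1 : ∀ s ∈ Set.Ioo (-δ) δ, 1 < ‖Φ (p + s * v)‖)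
    (hconv : StrictConvexOn ℝ (Set.Ioo (-δ) δ) fun s : ℝ => Real.log ‖Φ (p + s * v)‖)
    {s : Fin m → ℝ} (hs : ∀ i, s i ∈ Set.Ioo (-δ) δ) (hne : ∃ i j, s i ≠ s j) {q : Fin m → ℂ}
    (hq : ∀ i, q i ^ m * Φ (p + s i * v) = 1) :
    ‖Φ (∑ i, (p + s i * v) / (m : ℂ)) * ∏ i, q i‖ < 1 := by
  have hm0 : (m : ℝ) ≠ 0 := by exact_mod_cast (by omega : m ≠ 0)
  have hm0' : (m : ℂ) ≠ 0 := by exact_mod_cast (by omega : m ≠ 0)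
  have hmpos : (0 : ℝ) < m := by exact_mod_cast hm
  obtain ⟨i, j, hij⟩ := hne
  have hw1 : ∑ _i : Fin m, (1 / m : ℝ) = 1 := by
    simp [mul_inv_cancel₀ hm0]
  -- Strict Jensen with equal weights. As $\log|q_i|=-\frac1m\log|\Phi(\lambda_i)|$, it says
  -- precisely that the logarithm of the product is negative.
  have hjen := hconv.map_sum_lt (t := Finset.univ) (w := fun _ => (1 / m : ℝ)) (p := s)
    (fun _ _ => by positivity) hw1 (fun i _ => hs i)
    ⟨i, Finset.mem_univ _, j, Finset.mem_univ _, hij⟩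
  have hbar : ∑ i, (p + s i * v) / (m : ℂ) = p + ((∑ i, (1 / m : ℝ) • s i : ℝ) : ℂ) * v := by
    push_cast
    simp only [add_div, Finset.sum_add_distrib, Finset.sum_mul, smul_eq_mul]
    push_cast
    congr 1
    · simp [mul_div_cancel₀ _ hm0']
    · exact Finset.sum_congr rfl fun i _ => by ring
  have hmem : ∑ i, (1 / m : ℝ) • s i ∈ Set.Ioo (-δ) δ :=
    (convex_Ioo (-δ) δ).sum_mem (fun _ _ => by positivity) hw1 fun i _ => hs i
  have hqn : ∀ i, q i ≠ 0 := by
    intro i h0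
    have := hq i
    rw [h0, zero_pow (by omega), zero_mul] at this
    exact zero_ne_one this
  have hlogq : ∀ i, Real.log ‖q i‖ = -((1 / m : ℝ) • Real.log ‖Φ (p + s i * v)‖) := by
    intro i
    have h2 : ‖q i‖ ^ m * ‖Φ (p + s i * v)‖ = 1 := by
      rw [← norm_pow, ← norm_mul, hq, norm_one]
    have h3 := congrArg Real.log h2
    rw [Real.log_mul (pow_ne_zero _ (norm_ne_zero_iff.2 (hqn i)))
      (zero_lt_one.trans (h1 _ (hs i))).ne', Real.log_pow, Real.log_one] at h3
    rw [smul_eq_mul]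
    field_simp
    linarith
  have hΦpos := zero_lt_one.trans (h1 _ hmem)
  rw [hbar, norm_mul, norm_prod]
  have hppos : 0 < ∏ i, ‖q i‖ := Finset.prod_pos fun i _ => norm_pos_iff.2 (hqn i)
  rw [← Real.log_neg_iff (mul_pos hΦpos hppos), Real.log_mul hΦpos.ne' hppos.ne',
    Real.log_prod fun i _ => norm_ne_zero_iff.2 (hqn i)]
  simp only [hlogq, Finset.sum_neg_distrib]
  linarith

/-! ### Geometry of the frequencies along the ray. -/

/-- Transitivity of all powers for an operator with eigenvectors `E μ` and eigenvalues `Φ μ`, when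
`|Φ| < 1` on an open segment from the origin to a point where `1 ≤ |Φ|`. -/
theorem powerTransitive_of_ray {X : Type*} [CommRing X] [Algebra ℂ X] [TopologicalSpace X]
    [IsTopologicalRing X] [ContinuousSMul ℂ X] {E : ℂ → X} {Φ : ℂ → ℂ} (hzero : E 0 = 1)
    (hadd : ∀ μ ν, E (μ + ν) = E μ * E ν) {T : X →L[ℂ] X} (hT : ∀ μ, T (E μ) = Φ μ • E μ)
    (hdense : ∀ p v : ℂ, v ≠ 0 → ∀ α β : ℝ, α < β →
      Dense (Submodule.span ℂ ((fun s : ℝ => E (p + s * v)) '' Set.Ioo α β) : Set X))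
    (hΦ : Differentiable ℂ Φ)
    (hnl : ∀ U : Set ℂ, IsOpen U → U.Nonempty →
      ∃ p ∈ U, Φ p * deriv (deriv Φ) p ≠ deriv Φ p ^ 2)
    {w : ℂ} {t₀ : ℝ} (ht₀ : 0 < t₀) (hin : ∀ t ∈ Set.Ioo 0 t₀, ‖Φ (t * w)‖ < 1)
    (hout : 1 ≤ ‖Φ (t₀ * w)‖) : PowerTransitive T := by
  intro m hm U V W hU hUne hV hVne hW hW0
  have hmpos : (0 : ℝ) < m := by exact_mod_cast hm
  have hm1 : (1 : ℝ) ≤ m := by exact_mod_cast hm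
  have hw : w ≠ 0 := by
    rintro rfl
    have := hin (t₀ / 2) ⟨by linarith, by linarith⟩
    simp only [mul_zero] at this hout
    linarith
  set τ : ℝ := t₀ / m with hτ
  have hτpos : 0 < τ := by positivity
  have hmτ : m * τ = t₀ := mul_div_cancel₀ _ hmpos.ne'
  -- Every sum of frequencies containing some $\lambda/m$, but not exactly $m$ of them, lies within
  -- $\eta$ of this compact piece of the ray, where $|\Phi|<1$ holds with room to spare.
  have hK : IsCompact ((fun t : ℝ => (t : ℂ) * w) '' Set.Icc τ (t₀ - τ / 2)) :=
    isCompact_Icc.image (by fun_prop)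
  obtain ⟨η, hη, hthick⟩ := hK.exists_thickening_subset_open
    (isOpen_lt hΦ.continuous.norm continuous_const : IsOpen {z | ‖Φ z‖ < 1}) (by
      rintro _ ⟨t, ht, rfl⟩
      exact hin t ⟨by linarith [ht.1], by linarith [ht.2]⟩)
  obtain ⟨p, v, hv, δ, hδ, hseg, hconv⟩ := exists_segment_strictConvexOn hΦ hnl
    (Metric.isOpen_ball (x := (t₀ * w : ℂ)) (ε := η)) (Metric.mem_ball_self hη) hout
  have hroot : ∀ lam, ∃ c : ℂ, c ^ m = (Φ lam)⁻¹ := fun lam =>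
    IsAlgClosed.exists_pow_nat_eq _ hm
  choose q hq using hroot
  set Γ : Set ℂ := (fun s : ℝ => (s : ℂ) * w) '' Set.Ioo 0 (τ / 2) with hΓdef
  set L : Set ℂ := (fun s : ℝ => p + s * v) '' Set.Ioo (-δ) δ with hLdef
  have hΓ : Dense (Submodule.span ℂ (E '' Γ) : Set X) := by
    rw [hΓdef, Set.image_image]
    simpa using hdense 0 w hw 0 (τ / 2) (by linarith)
  have hL : Dense (Submodule.span ℂ (E '' L) : Set X) := by
    rw [hLdef, Set.image_image]
    exact hdense p v hv (-δ) δ (by linarith)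
  have hL1 : ∀ lam ∈ L, 1 < ‖Φ lam‖ := by
    rintro _ ⟨s, hs, rfl⟩
    exact (hseg s hs).2
  have hLq : ∀ lam ∈ L, q lam ^ m * Φ lam = 1 := by
    intro lam hlam
    rw [hq, inv_mul_cancel₀ (norm_pos_iff.1 (zero_lt_one.trans (hL1 lam hlam)))]
  have hLq1 : ∀ lam ∈ L, ‖q lam‖ < 1 := by
    intro lam hlam
    by_contra hge
    have h2 : ‖q lam‖ ^ m * ‖Φ lam‖ = 1 := by
      rw [← norm_pow, ← norm_mul, hLq lam hlam, norm_one]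
    have h3 := one_le_pow₀ (not_lt.1 hge) (n := m)
    nlinarith [hL1 lam hlam]
  refine exists_pow_mem_of_eigenvectors hzero hadd hT hm hΓ hL hLq hLq1 ?_ hU hUne hV hVne hW hW0
  intro j hj hjm κ hκ hdiag
  have hjm' : (j : ℝ) ≤ m := by exact_mod_cast hjm
  have hq1 : ∀ i, ‖(Sum.elim 1 q (κ i) : ℂ)‖ ≤ 1 := by
    intro i
    have := hκ i
    revert this
    rcases κ i with γ | lam <;> intro this
    · simp
    · exact (hLq1 lam this).le
  -- Each frequency is a point $\sigma w$ of the ray plus an error: $\gamma$ has $\sigma<\tau/2$ and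
  -- no error, $\lambda/m$ has $\sigma=\tau$ and error below $\eta/m$, so at most $m$ errors add up
  -- to less than $\eta$.
  have hdec : ∀ i, ∃ (σ : ℝ) (e : ℂ), Sum.elim id (· / (m : ℂ)) (κ i) = σ * w + e ∧
      0 < σ ∧ σ ≤ τ ∧ ‖e‖ < η / m ∧ ((κ i).isLeft → σ < τ / 2 ∧ e = 0) ∧
      ((κ i).isRight → σ = τ) := by
    intro i
    have := hκ i
    revert this
    rcases κ i with γ | lam <;> intro this
    · obtain ⟨s, hs, rfl⟩ := this
      exact ⟨s, 0, by simp, hs.1, by linarith [hs.2], by simpa using by positivity,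
        fun _ => ⟨hs.2, rfl⟩, by simp⟩
    · obtain ⟨s, hs, rfl⟩ := this
      refine ⟨τ, (p + s * v - t₀ * w) / m, ?_, hτpos, le_rfl, ?_, by simp, fun _ => rfl⟩
      · simp only [Sum.elim_inr, hτ]
        push_cast
        ring
      · rw [norm_div, Complex.norm_natCast]
        gcongr
        simpa [dist_eq_norm] using (hseg s hs).1
  choose σ e hσe hσ0 hστ he hleft hright using hdec
  have hsum : ∑ i, Sum.elim id (· / (m : ℂ)) (κ i) = ((∑ i, σ i : ℝ) : ℂ) * w + ∑ i, e i := by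
    simp only [hσe, Finset.sum_add_distrib, Complex.ofReal_sum, Finset.sum_mul]
  have hprod : ‖∏ i, (Sum.elim 1 q (κ i) : ℂ)‖ ≤ 1 := by
    rw [norm_prod]
    exact Finset.prod_le_one (fun _ _ => norm_nonneg _) fun i _ => hq1 i
  have hj0 : (Finset.univ : Finset (Fin j)).Nonempty := ⟨⟨0, hj⟩, Finset.mem_univ _⟩
  have hjτ : j * τ ≤ t₀ := by
    rw [← hmτ]
    gcongr
  have hreduce : ‖Φ (((∑ i, σ i : ℝ) : ℂ) * w + ∑ i, e i)‖ < 1 →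
      ‖Φ (∑ i, Sum.elim id (· / (m : ℂ)) (κ i)) * ∏ i, Sum.elim 1 q (κ i)‖ < 1 := by
    intro hlt
    rw [hsum, norm_mul]
    exact mul_lt_one_of_nonneg_of_lt_one_left (norm_nonneg _) hlt hprod
  -- With only $\gamma$'s there is no lower bound $\tau$ for the sum, but it lies exactly on the
  -- ray, strictly between $0$ and $t_0w$.
  by_cases hallL : ∀ i, (κ i).isLeft
  · refine hreduce ?_
    have he0 : ∑ i, e i = 0 := Finset.sum_eq_zero fun i _ => (hleft i (hallL i)).2
    rw [he0, add_zero]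
    refine hin _ ⟨Finset.sum_pos (fun i _ => hσ0 i) hj0, ?_⟩
    have h1 : ∑ i, σ i < ∑ _i : Fin j, τ :=
      Finset.sum_lt_sum_of_nonempty hj0 fun i _ => by linarith [(hleft i (hallL i)).1]
    simp only [Finset.sum_const, Finset.card_univ, Fintype.card_fin, nsmul_eq_mul] at h1
    linarith
  obtain ⟨i₀, hi₀⟩ := not_forall.1 hallL
  have hi₀ : (κ i₀).isRight := by simpa using hi₀
  by_cases hallR : j = m ∧ ∀ i, (κ i).isRight
  · obtain ⟨rfl, hR⟩ := hallR
    have hex : ∀ i, ∃ s ∈ Set.Ioo (-δ) δ, κ i = Sum.inr (p + s * v) := by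
      intro i
      have h1 := hκ i
      have h2 := hR i
      revert h1 h2
      rcases κ i with γ | lam <;> intro h1 h2
      · simp at h2
      · obtain ⟨s, hs, rfl⟩ := h1
        exact ⟨s, hs, rfl⟩
    choose s hs hκs using hex
    simp only [hκs, Sum.elim_inr]
    refine norm_mul_prod_root_lt_one hm (fun s hs => (hseg s hs).2) hconv hs ?_
      fun i => hLq _ ⟨s i, hs i, rfl⟩
    by_contra hall
    push Not at hall
    exact hdiag rfl ⟨p + s i₀ * v, fun i => by rw [hκs i, hall i i₀]⟩
  refine hreduce (hthick (Metric.mem_thickening_iff.2 ⟨_, ⟨∑ i, σ i, ⟨?_, ?_⟩, rfl⟩, ?_⟩))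
  · rw [← hright i₀ hi₀]
    exact Finset.single_le_sum (fun i _ => (hσ0 i).le) (Finset.mem_univ i₀)
  -- The upper end $t_0-\tau/2$: fewer than $m$ terms give at most $t_0-\tau$, and with $m$ terms
  -- one $\gamma$ already loses $\tau/2$.
  · by_cases hlt : j < m
    · have h1 : ∑ i, σ i ≤ ∑ _i : Fin j, τ := Finset.sum_le_sum fun i _ => hστ i
      simp only [Finset.sum_const, Finset.card_univ, Fintype.card_fin, nsmul_eq_mul] at h1
      have h2 : (j : ℝ) + 1 ≤ m := by exact_mod_cast hlt
      nlinarith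
    · have hjm2 : j = m := by omega
      obtain ⟨i₁, hi₁⟩ := not_forall.1 fun h => hallR ⟨hjm2, h⟩
      have hi₁ : (κ i₁).isLeft := by simpa using hi₁
      have h1 : τ - σ i₁ ≤ ∑ i, (τ - σ i) :=
        Finset.single_le_sum (f := fun i => τ - σ i) (fun i _ => by linarith [hστ i])
          (Finset.mem_univ i₁)
      simp only [Finset.sum_sub_distrib, Finset.sum_const, Finset.card_univ, Fintype.card_fin,
        nsmul_eq_mul] at h1
      linarith [(hleft i₁ hi₁).1]
  · rw [dist_eq_norm, add_sub_cancel_left]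
    calc ‖∑ i, e i‖ ≤ ∑ i, ‖e i‖ := norm_sum_le _ _
      _ < ∑ _i : Fin j, η / m := Finset.sum_lt_sum_of_nonempty hj0 fun i _ => he i
      _ = j * (η / m) := by simp
      _ ≤ m * (η / m) := by gcongr
      _ = η := mul_div_cancel₀ _ hmpos.ne'

/-! ### The choice of ray and the conclusion. -/

/-- If `|φ| < 1` just after the origin on a ray and `1 ≤ |φ|` somewhere on it, there is a first
point where `1 ≤ |φ|`. -/
theorem exists_first_crossing {g : ℝ → ℝ} (hg : Continuous g)
    (h0 : ∀ᶠ t in 𝓝[>] 0, g t < 1) {s : ℝ} (hs : 0 < s) (hgs : 1 ≤ g s) :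
    ∃ t₀ : ℝ, 0 < t₀ ∧ (∀ t ∈ Set.Ioo 0 t₀, g t < 1) ∧ 1 ≤ g t₀ := by
  obtain ⟨ε, hε, hlt⟩ := (mem_nhdsGT_iff_exists_Ioo_subset).1 h0
  have hε : 0 < ε := hε
  have hεs : ε ≤ s := by
    by_contra hh
    exact absurd (hlt ⟨hs, not_le.1 hh⟩ : g s < 1) (not_lt.2 hgs)
  have hK : IsCompact (Set.Icc ε s ∩ {t | 1 ≤ g t}) :=
    isCompact_Icc.inter_right (isClosed_le continuous_const hg)
  obtain ⟨t₀, ht₀, hmin⟩ := hK.exists_isLeast ⟨s, ⟨hεs, le_rfl⟩, hgs⟩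
  refine ⟨t₀, hε.trans_le ht₀.1.1, fun t ht => ?_, ht₀.2⟩
  by_contra hge
  rcases lt_or_ge t ε with h | h
  · exact hge (hlt ⟨ht.1, h⟩)
  · exact absurd (hmin ⟨⟨h, ht.2.le.trans ht₀.1.2⟩, not_lt.1 hge⟩) (not_le.2 ht.2)

/-- A holomorphic function with `|φ 0| = 1` enters the unit disc in every direction `w` with
`Re (conj (φ 0) * φ' 0 * w) < 0`. -/
theorem eventually_norm_lt_one {φ : ℂ → ℂ} (hφ : Differentiable ℂ φ) (hφ0 : ‖φ 0‖ = 1) {w : ℂ}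
    (hw : ((starRingEnd ℂ) (φ 0) * (deriv φ 0 * w)).re < 0) :
    ∀ᶠ t : ℝ in 𝓝[>] 0, ‖φ (t * w)‖ < 1 := by
  have h1 : HasDerivAt (fun t : ℝ => φ (t * w)) (deriv φ 0 * w) 0 := by
    have h2 : HasDerivAt (fun x : ℂ => φ (x * w)) (deriv φ 0 * w) ((0 : ℝ) : ℂ) := by
      have h3 : HasDerivAt (fun x : ℂ => x * w) w ((0 : ℝ) : ℂ) := by
        simpa using (hasDerivAt_id ((0 : ℝ) : ℂ)).mul_const w
      have h4 : HasDerivAt φ (deriv φ 0) (((0 : ℝ) : ℂ) * w) := by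
        simpa using (hφ 0).hasDerivAt
      exact HasDerivAt.comp (h₂ := φ) (h := fun x : ℂ => x * w) ((0 : ℝ) : ℂ) h4 h3
    exact h2.comp_ofReal
  -- The squared modulus is differentiable and, by the choice of $w$, has negative derivative at its
  -- value $1$.
  have h2 : HasDerivAt (fun t : ℝ => ‖φ (t * w)‖ ^ 2)
      (2 * ((starRingEnd ℂ) (φ 0) * (deriv φ 0 * w)).re) 0 := by
    refine h1.norm_sq.congr_deriv ?_
    rw [Complex.inner]
    simp [mul_comm]
  have h3 := h2.tendsto_slope_zero_right
  filter_upwards [h3.eventually_lt_const (by linarith : _ < (0 : ℝ)), self_mem_nhdsWithin]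
    with t ht ht0
  have ht0 : 0 < t := ht0
  simp only [zero_add, Complex.ofReal_zero, zero_mul, hφ0, smul_eq_mul] at ht
  have h4 : ‖φ (t * w)‖ ^ 2 - 1 ^ 2 < 0 := by
    by_contra hge
    have := mul_nonneg (inv_pos.2 ht0).le (not_lt.1 hge)
    linarith
  nlinarith [norm_nonneg (φ (t * w))]

/-- In the degenerate case $\Phi$ is an exponential, hence $\varphi(z)=\varphi(0)e^{(c-a)z}$. This
has constant modulus along a line through $0$, so it is bounded on a ray and therefore constant. -/
theorem not_logDeriv_locally_const_exp_mul {a : ℂ} {φ : ℂ → ℂ} (hφ : Differentiable ℂ φ)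
    (hnonconst : ¬ ∃ c, ∀ z, φ z = c) (hφ0 : φ 0 ≠ 0)
    (hb : ∀ ε : ℝ, 0 < ε → ∃ C : ℝ, ∀ z, ‖φ z‖ ≤ C * Real.exp (ε * √‖z‖))
    {Φ : ℂ → ℂ} (hΦ : Φ = fun z => Complex.exp (a * z) * φ z) {U : Set ℂ} (hU : IsOpen U)
    (hUne : U.Nonempty) : ∃ p ∈ U, Φ p * deriv (deriv Φ) p ≠ deriv Φ p ^ 2 := by
  by_contra hall
  push Not at hall
  have hd : Differentiable ℂ Φ := by
    rw [hΦ]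
    fun_prop
  obtain ⟨c, hc⟩ := eq_exp_of_logDeriv_locally_const hd (by simpa [hΦ] using hφ0) hU hUne hall
  have hφc : ∀ z, φ z = φ 0 * Complex.exp ((c - a) * z) := by
    intro z
    have h1 := hc z
    simp only [hΦ, mul_zero, Complex.exp_zero, one_mul] at h1
    rw [sub_mul, Complex.exp_sub, ← mul_div_assoc, ← h1,
      mul_div_cancel_left₀ _ (Complex.exp_ne_zero _)]
  obtain ⟨w, hw, hre⟩ : ∃ w : ℂ, w ≠ 0 ∧ ((c - a) * w).re = 0 := by
    rcases eq_or_ne (c - a) 0 with h | h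
    · exact ⟨1, one_ne_zero, by simp [h]⟩
    · refine ⟨Complex.I * (starRingEnd ℂ) (c - a), mul_ne_zero Complex.I_ne_zero 
        ((_root_.map_ne_zero _).2 h),
        ?_⟩
      rw [mul_left_comm, Complex.mul_conj]
      simp
  refine hnonconst (exists_eq_const_of_bounded_on_ray hφ hb hw (M := ‖φ 0‖) fun t _ => ?_)
  have h2 : ((c - a) * (t * w)).re = 0 := by
    rw [mul_left_comm, Complex.re_ofReal_mul, hre, mul_zero]
  rw [hφc, norm_mul, Complex.norm_exp, h2, Real.exp_zero, mul_one]

theorem corollary3p3 (a : ℂ) (φ : ℂ → ℂ) (hφ : Differentiable ℂ φ)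
    (hnonconst : ¬ ∃ c, ∀ z, φ z = c)
    (hgrowth : IsOfGrowth φ (1 / 2) 0)
    (hφ0 : ‖φ 0‖ = 1)
    (him : (a * φ 0 * (starRingEnd ℂ) (deriv φ 0)).im ≠ 0) :
    (∀ f : EntireFunctions,
      Summable (convolutionTerm (fun z => Complex.exp (a * z) * φ z) f)) ∧
    (∃ T : EntireFunctions →L[ℂ] EntireFunctions,
      ∀ f, T f = convolutionOperator (fun z => Complex.exp (a * z) * φ z) f) ∧
    SupportsHypercyclicAlgebra (convolutionOperator (fun z => Complex.exp (a * z) * φ z)) := by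
  set Φ : ℂ → ℂ := fun z => Complex.exp (a * z) * φ z with hΦdef
  have hΦ : Differentiable ℂ Φ := by fun_prop
  have hb : ∀ ε : ℝ, 0 < ε → ∃ C : ℝ, ∀ z, ‖φ z‖ ≤ C * Real.exp (ε * √‖z‖) :=
    fun ε hε => hgrowth.exists_norm_le hφ hnonconst hε
  have hφ0ne : φ 0 ≠ 0 := by
    rw [← norm_pos_iff, hφ0]
    exact one_pos
  obtain ⟨C, hC⟩ := hb 1 one_pos
  have hexp : ∀ z, ‖Φ z‖ ≤ (C * Real.exp 1) * Real.exp ((‖a‖ + 1) * ‖z‖) := by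
    intro z
    have hC0 : 0 ≤ C := by simpa using (norm_nonneg _).trans (hC 0)
    have h1 : ‖Complex.exp (a * z)‖ ≤ Real.exp (‖a‖ * ‖z‖) := by
      rw [← norm_mul]
      exact Complex.norm_exp_le_exp_norm _
    have h2 : √‖z‖ ≤ 1 + ‖z‖ := Real.sqrt_le_iff.2 ⟨by positivity, by nlinarith [norm_nonneg z]⟩
    calc ‖Φ z‖ = ‖Complex.exp (a * z)‖ * ‖φ z‖ := norm_mul _ _
      _ ≤ Real.exp (‖a‖ * ‖z‖) * (C * Real.exp (1 * √‖z‖)) := by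
          gcongr
          exact hC z
      _ ≤ Real.exp (‖a‖ * ‖z‖) * (C * Real.exp (1 + ‖z‖)) := by
          rw [one_mul]
          gcongr
      _ = _ := by
          rw [add_mul, Real.exp_add, Real.exp_add, one_mul]
          ring
  obtain ⟨T, hT⟩ := EntireFunctions.exists_convolutionCLM hΦ hexp
  refine ⟨fun f => (EntireFunctions.hasSum_convolutionTerm hΦ hexp f).1.summable, ⟨T, hT⟩, ?_⟩
  obtain ⟨w, hw, haw, hbw⟩ : ∃ w : ℂ, w ≠ 0 ∧ (a * w).re = 0 ∧
      ((starRingEnd ℂ) (φ 0) * (deriv φ 0 * w)).re < 0 := by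
    have ha : a ≠ 0 := by
      rintro rfl
      simp at him
    set y := (a * φ 0 * (starRingEnd ℂ) (deriv φ 0)).im with hy
    -- With $w=-iy\bar a$, $aw=-iy|a|^2$ is imaginary, while
    -- $\operatorname{Re}(\overline{\varphi(0)}\varphi'(0)w)=-y^2$; the factor $y$ selects the
    -- inward of the two directions.
    refine ⟨-(y : ℂ) * (Complex.I * (starRingEnd ℂ) a), ?_, ?_, ?_⟩
    · simp [ha, him]
    · simp
      ring
    · have h1 : ((starRingEnd ℂ) (φ 0) * (deriv φ 0 * (-(y : ℂ) * (Complex.I * (starRingEnd ℂ) a)))).re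
          = -y ^ 2 := by
        rw [sq]
        nth_rewrite 3 [hy]
        simp
        ring
      rw [h1]
      have := sq_pos_of_ne_zero him
      linarith
  have hnorm : ∀ t : ℝ, ‖Φ (t * w)‖ = ‖φ (t * w)‖ := by
    intro t
    have : (a * (t * w)).re = 0 := by
      rw [mul_left_comm, Complex.re_ofReal_mul, haw, mul_zero]
    rw [hΦdef]
    simp only [norm_mul, Complex.norm_exp, this, Real.exp_zero, one_mul]
  obtain ⟨s, hs, hs1⟩ : ∃ s : ℝ, 0 < s ∧ 1 ≤ ‖φ (s * w)‖ := by
    by_contra hall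
    push Not at hall
    refine hnonconst (exists_eq_const_of_bounded_on_ray hφ hb hw (M := 1) fun t ht => ?_)
    rcases ht.eq_or_lt with rfl | ht
    · simp [hφ0]
    · exact (hall t ht).le
  obtain ⟨t₀, ht₀, hin, hout⟩ := exists_first_crossing (g := fun t : ℝ => ‖φ (t * w)‖)
    (by have := hφ.continuous; fun_prop) (eventually_norm_lt_one hφ hφ0 hbw) hs hs1
  have htrans : PowerTransitive T :=
    powerTransitive_of_ray EntireFunctions.expFun_zero EntireFunctions.expFun_add
      (fun μ => by rw [hT, EntireFunctions.convolutionOperator_expFun hΦ hexp])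
      (fun p v hv α β hαβ => EntireFunctions.dense_span_expFun p v hv hαβ) hΦ
      (fun U hU hUne => not_logDeriv_locally_const_exp_mul hφ hnonconst hφ0ne hb hΦdef hU hUne)
      ht₀ (fun t ht => by rw [hnorm]; exact hin t ht) (by rw [hnorm]; exact hout)
  have hfun : convolutionOperator Φ = T := funext fun f => (hT f).symm
  rw [hfun]
  exact htrans.supportsHypercyclicAlgebra
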